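/- Let $0<L<L_0$ and let $\alpha:[-L_0,L_0]\to\mathbb R$ be continuous. For $T>0$, let $\mathscr R_L(T)$ be the set of states $u(T,\cdot)$ on $(-L,L)$, where $u$ is the (complex-valued, transposition) solution of $$\partial_t u-\partial_{xx}u=0 \text{ in }(0,T)\times(-L,L),\quad u(t,-L)=v_-(t),\ u(t,L)=v_+(t)\text{ in }(0,T),\quad u(0,\cdot)=0,$$ for some controls $v_-,v_+\in L^2(0,T;\mathbb C)$. For $h\in L^2(-L_0,L_0;\mathbb C)$ define $$g(t,x)=\frac1{t^{3/2}}\exp\Big(\frac{x^2-L_0^2}{4t}+i\,\frac{\alpha(x)}{4t}\Big)h(x),\qquad (t,x)\in(0,\infty)\times(-L_0,L_0).$$ Then the state $$w_0(x)=\int_0^\infty\!\!\int_{-L_0}^{L_0}\frac1{\sqrt{4\pi t}}\exp\Big(-\frac{(x-\tilde x)^2}{4t}\Big)g(t,\tilde x)\,d\tilde x\,dt,\qquad x\in(-L,L),$$ is well defined (the double integral converges absolutely for every $x\in(-L,L)$), belongs to $L^2(-L,L)$, and belongs to $\mathscr R_L(T)$ for every $T>0$. Moreover, for every $x\in(-L,L)$,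 $$w_0(x)=\frac2{\sqrt\pi}\int_{-L_0}^{L_0}\frac{h(\tilde x)}{(x-\tilde x)^2+L_0^2-\tilde x^2-i\,\alpha(\tilde x)}\,d\tilde x ,$$ the integral being absolutely convergent. Consequently, for the operator $K_\alpha:L^2(-L_0,L_0)\to L^2(-L,L)$ given by the absolutely convergent integral $$K_\alpha(h)(x)=\frac2{\sqrt\pi}\int_{-L_0}^{L_0}\frac{h(\tilde x)}{(x-\tilde x)^2+L_0^2-\tilde x^2+i\,\alpha(\tilde x)}\,d\tilde x,\qquad x\in(-L,L),$$ one has $\mathrm{Range}(K_\alpha)\subset\mathscr R_L(T)$ for every $T>0$. -/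

import Mathlib

open MeasureTheory Set
open scoped ContDiff

noncomputable section

namespace HeatReach

/-- `u` solves `∂ₜu - ∂ₓₓu = 0` in `(0,T) × (-L,L)`, `u(t,-L) = vm t`, `u(t,L) = vp t`, `u(0,·) = 0`,
with complex-valued `L²` boundary data, in the sense of transposition: `u ∈ L²((0,T) × (-L,L))` and,
for every time `τ ∈ [0,T]` and every smooth `φ` vanishing on the lateral boundary,
`∫ u(τ) φ(τ) dx = ∫₀^τ ∫ u (∂ₜφ + ∂ₓₓφ) dx dt + ∫₀^τ (vm ∂ₓφ(t,-L) - vp ∂ₓφ(t,L)) dt`.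
For `τ = 0` this is the initial condition. For a general `L²` boundary datum `u(τ)` need not be
integrable up to `x = ±L`, but its product with such a `φ(τ)` is. -/
structure IsSolution (L T : ℝ) (vm vp : ℝ → ℂ) (u : ℝ → ℝ → ℂ) : Prop where
  memLp : MemLp (Function.uncurry u) 2 (volume.restrict (Ioo 0 T ×ˢ Ioo (-L) L))
  weak : ∀ τ ∈ Icc (0 : ℝ) T, ∀ φ : ℝ → ℝ → ℂ, ContDiff ℝ ∞ (Function.uncurry φ) →
    (∀ t ∈ Icc (0 : ℝ) τ, φ t (-L) = 0 ∧ φ t L = 0) →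
    IntegrableOn (fun x => u τ x * φ τ x) (Ioo (-L) L) ∧
    ∫ x in Ioo (-L) L, u τ x * φ τ x =
      (∫ p in Ioo 0 τ ×ˢ Ioo (-L) L,
        u p.1 p.2 * (deriv (fun t => φ t p.2) p.1 + deriv (deriv (φ p.1)) p.2)) +
      ∫ t in Ioo 0 τ, (vm t * deriv (φ t) (-L) - vp t * deriv (φ t) L)

/-- The set of states `u(T)` reached at time `T` (functions on `(-L,L)`, up to null sets) by
solutions with controls in `L²(0,T)`. -/
def reachableSet (L T : ℝ) : Set (ℝ → ℂ) :=
  {w | ∃ vm vp : ℝ → ℂ, ∃ u : ℝ → ℝ → ℂ,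
    MemLp vm 2 (volume.restrict (Ioo 0 T)) ∧ MemLp vp 2 (volume.restrict (Ioo 0 T)) ∧
    IsSolution L T vm vp u ∧ u T =ᵐ[volume.restrict (Ioo (-L) L)] w}

/-- The source `g(t,x) = t^{-3/2} exp((x² - L₀²)/4t + i α(x)/4t) h(x)`. -/
def source (L₀ : ℝ) (α : ℝ → ℝ) (h : ℝ → ℂ) (t x : ℝ) : ℂ :=
  1 / ((t ^ (3 / 2 : ℝ) : ℝ) : ℂ) *
    Complex.exp (((x ^ 2 - L₀ ^ 2) / (4 * t) : ℝ) + Complex.I * ((α x / (4 * t) : ℝ) : ℂ)) * h x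

/-- The heat kernel of the line. -/
def heatKernel (t x : ℝ) : ℝ :=
  1 / Real.sqrt (4 * Real.pi * t) * Real.exp (-x ^ 2 / (4 * t))

/-- `w₀(x) = ∫∫ heatKernel t (x - y) g(t,y)` over `(t,y) ∈ (0,∞) × (-L₀,L₀)`. -/
def w₀ (L₀ : ℝ) (α : ℝ → ℝ) (h : ℝ → ℂ) (x : ℝ) : ℂ :=
  ∫ p in Ioi (0 : ℝ) ×ˢ Ioo (-L₀) L₀, (heatKernel p.1 (x - p.2) : ℂ) * source L₀ α h p.1 p.2

/-- The integrand `h(y) / ((x - y)² + L₀² - y² + i α(y))` of `K_α`. -/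
def kernelIntegrand (L₀ : ℝ) (α : ℝ → ℝ) (h : ℝ → ℂ) (x y : ℝ) : ℂ :=
  h y / ((((x - y) ^ 2 + L₀ ^ 2 - y ^ 2 : ℝ) : ℂ) + Complex.I * (α y : ℂ))

/-- `K_α(h)(x) = (2/√π) ∫_{-L₀}^{L₀} h(y) / ((x - y)² + L₀² - y² + i α(y)) dy`. -/
def K (L₀ : ℝ) (α : ℝ → ℝ) (h : ℝ → ℂ) (x : ℝ) : ℂ :=
  ((2 / Real.sqrt Real.pi : ℝ) : ℂ) * ∫ y in Ioo (-L₀) L₀, kernelIntegrand L₀ α h x y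

/-- The range of `K_α` on `L²(-L₀,L₀)`. -/
def rangeK (L₀ : ℝ) (α : ℝ → ℝ) : Set (ℝ → ℂ) :=
  {k | ∃ h : ℝ → ℂ, MemLp h 2 (volume.restrict (Ioo (-L₀) L₀)) ∧ k = K L₀ α h}

end HeatReach

end

noncomputable section

namespace HeatReach

/-! Write `A = (x - y)² + L₀² - y² - iα(y)`. The product of the heat kernel and the source is a
constant times `t⁻² exp (-A / 4t) h(y)`, and `Re A ≥ (L₀ - L)² > 0` for `|x| ≤ L`, `|y| ≤ L₀`. Since
`∫₀^∞ t⁻² exp (-A / 4t) dt = 4 / A`, Fubini gives absolute convergence and the formula for `w₀`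
(`integrable_heatKernel_source`, `w₀_eq`).

Reachability is not immediate, because some sources lie inside `(-L, L)` and because they act for an
infinite time.

Position of the sources. As a polynomial in `x`, `A` has the roots `p = y ± r` with `r² = y² - L₀² +
iα(y)`. Partial fractions reduce `1 / A` to simple poles, and `1 / (x - p) = ((p - z) + (x - z)) /
((x - z)² - (p - z)²)` for every `z`. With `z = L₀` or `z = -L₀` according to the sign of `Re p`,
the number `c = -(p - z)²` has nonnegative real part. The two terms are then states emitted by a
heat monopole and a heat dipole at `z`, outside `[-L, L]`, with amplitudes `t^(-3/2) exp (-c / 4t)`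
and `t^(-1/2) exp (-c / 4t)` (`bddReachable_inner_pole`). The coefficient `1 / 2r` may blow up as
`|y| → L₀`; but sources with `|y| > (L + L₀) / 2` are already outside `[-L, L]` and need no
relocation (`bddReachable_outer`).

Infinite time. Emission during the last `T` units of time is a superposition of solutions that start
from zero (`bddReachable_truncated`). The older emission leaves the factor `4 (1 - exp (-A / 4T)) /
A`, which extends to an entire function of `x` of Gaussian growth (`bddReachable_remainder`). Such a
state is reachable by the flatness method: its backward heat evolution has traces at `x = 0` that
are analytic in time near `T`. Multiplying these traces by a Gevrey step of order two that is flat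
at both ends gives flat outputs which vanish at time `0` and carry the prescribed Taylor
coefficients at time `T` (`bddReachable_egf`).

Every solution used is bounded, so families of solutions are integrated by Fubini in the
transposition identity (`BoundedWeakSolution.of_superposition`). -/

/-! ### Solutions by transposition, superposition, reachable states -/

/-- The transposition identity at time `τ` for the test function `φ`, with the traces of `u` as
boundary data. -/
def WeakIdentity (L τ : ℝ) (u φ : ℝ → ℝ → ℂ) : Prop :=
  ∫ x in Ioo (-L) L, u τ x * φ τ x =
    (∫ p in Ioo 0 τ ×ˢ Ioo (-L) L,
      u p.1 p.2 * (deriv (fun t => φ t p.2) p.1 + deriv (deriv (φ p.1)) p.2)) +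
    ∫ t in Ioo 0 τ, (u t (-L) * deriv (φ t) (-L) - u t L * deriv (φ t) L)

/-- A measurable bounded solution in the sense of transposition, with its own traces as boundary
data. -/
structure BoundedWeakSolution (L T : ℝ) (u : ℝ → ℝ → ℂ) : Prop where
  measurable : Measurable (Function.uncurry u)
  bounded : ∃ C : ℝ, ∀ s ∈ Icc (0 : ℝ) T, ∀ x ∈ Icc (-L) L, ‖u s x‖ ≤ C
  weak : ∀ τ ∈ Icc (0 : ℝ) T, ∀ φ : ℝ → ℝ → ℂ, ContDiff ℝ ∞ (Function.uncurry φ) →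
    (∀ t ∈ Icc (0 : ℝ) τ, φ t (-L) = 0 ∧ φ t L = 0) → WeakIdentity L τ u φ

/-- The partial derivatives of a smooth function of two variables. -/
theorem exists_partial_derivs {φ : ℝ → ℝ → ℂ} (hφ : ContDiff ℝ ∞ (Function.uncurry φ)) :
    ∃ φt φx φxx : ℝ × ℝ → ℂ, Continuous φt ∧ Continuous φx ∧ Continuous φxx ∧
      (∀ t x, HasDerivAt (fun s => φ s x) (φt (t, x)) t) ∧
      (∀ t x, HasDerivAt (φ t) (φx (t, x)) x) ∧
      (∀ t x, HasDerivAt (fun y => φx (t, y)) (φxx (t, x)) x) := by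
  have key : ∀ f : ℝ × ℝ → ℂ, ContDiff ℝ ∞ f → ∀ v : ℝ × ℝ,
      ContDiff ℝ ∞ (fun p => fderiv ℝ f p v) := fun f hf v =>
    (hf.fderiv_right (m := ∞) (by simp)).clm_apply contDiff_const
  have hx : ∀ f : ℝ × ℝ → ℂ, ContDiff ℝ ∞ f → ∀ t x : ℝ,
      HasDerivAt (fun y => f (t, y)) (fderiv ℝ f (t, x) (0, 1)) x := by
    intro f hf t x
    have h1 : HasFDerivAt f (fderiv ℝ f (t, x)) (t, x) :=
      (hf.differentiable (by simp) (t, x)).hasFDerivAt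
    exact h1.comp_hasDerivAt x ((hasDerivAt_const x t).prodMk (hasDerivAt_id x))
  refine ⟨fun p => fderiv ℝ (Function.uncurry φ) p (1, 0),
    fun p => fderiv ℝ (Function.uncurry φ) p (0, 1),
    fun p => fderiv ℝ (fun q => fderiv ℝ (Function.uncurry φ) q (0, 1)) p (0, 1),
    (key _ hφ _).continuous, (key _ hφ _).continuous, (key _ (key _ hφ _) _).continuous,
    ?_, fun t x => hx _ hφ t x, fun t x => hx _ (key _ hφ _) t x⟩
  intro t x
  have h1 : HasFDerivAt (Function.uncurry φ) (fderiv ℝ (Function.uncurry φ) (t, x)) (t, x) :=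
    (hφ.differentiable (by simp) (t, x)).hasFDerivAt
  exact h1.comp_hasDerivAt t ((hasDerivAt_id t).prodMk (hasDerivAt_const t x))

/-- Classical solutions with vanishing initial state satisfy the transposition identity. -/
theorem weakIdentity_of_classical {L T : ℝ} (hL : 0 < L) {u ut ux : ℝ → ℝ → ℂ}
    (hu : ContinuousOn (Function.uncurry u) (Icc 0 T ×ˢ Icc (-L) L))
    (hut : ContinuousOn (Function.uncurry ut) (Icc 0 T ×ˢ Icc (-L) L))
    (ht : ∀ s ∈ Ioo 0 T, ∀ x ∈ Icc (-L) L, HasDerivAt (fun r => u r x) (ut s x) s)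
    (hx : ∀ s ∈ Ioo 0 T, ∀ x ∈ Icc (-L) L, HasDerivAt (u s) (ux s x) x)
    (hxx : ∀ s ∈ Ioo 0 T, ∀ x ∈ Icc (-L) L, HasDerivAt (ux s) (ut s x) x)
    (h0 : ∀ x ∈ Icc (-L) L, u 0 x = 0)
    {τ : ℝ} (hτ : τ ∈ Icc 0 T) {φ : ℝ → ℝ → ℂ} (hφ : ContDiff ℝ ∞ (Function.uncurry φ))
    (hb : ∀ t ∈ Icc (0 : ℝ) τ, φ t (-L) = 0 ∧ φ t L = 0) : WeakIdentity L τ u φ := by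
  obtain ⟨φt, φx, φxx, ct, cx, cxx, dt, dx, dxx⟩ := exists_partial_derivs hφ
  have cφ : Continuous (Function.uncurry φ) := hφ.continuous
  have e1 : ∀ t, deriv (φ t) = fun x => φx (t, x) := fun t => funext fun x => (dx t x).deriv
  have e2 : ∀ t x, deriv (fun s => φ s x) t = φt (t, x) := fun t x => (dt t x).deriv
  have e3 : ∀ t x, deriv (fun y => φx (t, y)) x = φxx (t, x) := fun t x => (dxx t x).deriv
  unfold WeakIdentity
  simp only [e1, e2, e3]
  have hLL : -L ≤ L := by linarith
  have hsub : Icc 0 τ ×ˢ Icc (-L) L ⊆ Icc 0 T ×ˢ Icc (-L) L :=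
    prod_mono (Icc_subset_Icc_right hτ.2) le_rfl
  have hK : IsCompact (Icc 0 τ ×ˢ Icc (-L) L) := isCompact_Icc.prod isCompact_Icc
  have hin : Ioo 0 τ ×ˢ Ioo (-L) L ⊆ Icc 0 τ ×ˢ Icc (-L) L :=
    prod_mono Ioo_subset_Icc_self Ioo_subset_Icc_self
  have hu' := hu.mono hsub
  have hut' := hut.mono hsub
  -- `Q = ∂ₜ(u φ)` and, because `∂ₓₓu = ∂ₜu`, `P = ∂ₓ(u ∂ₓφ - ∂ₓu φ)`. Their sum is `u (∂ₜφ +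
  -- ∂ₓₓφ)`, so each half is integrated exactly in its own variable.
  set Q : ℝ × ℝ → ℂ := fun p => ut p.1 p.2 * φ p.1 p.2 + u p.1 p.2 * φt p with hQ
  set P : ℝ × ℝ → ℂ := fun p => u p.1 p.2 * φxx p - ut p.1 p.2 * φ p.1 p.2 with hP
  have cQ : ContinuousOn Q (Icc 0 τ ×ˢ Icc (-L) L) :=
    (hut'.mul cφ.continuousOn).add (hu'.mul ct.continuousOn)
  have cP : ContinuousOn P (Icc 0 τ ×ˢ Icc (-L) L) :=
    (hu'.mul cxx.continuousOn).sub (hut'.mul cφ.continuousOn)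
  have iQ : IntegrableOn Q (Ioo 0 τ ×ˢ Ioo (-L) L) := (cQ.integrableOn_compact hK).mono_set hin
  have iP : IntegrableOn P (Ioo 0 τ ×ˢ Ioo (-L) L) := (cP.integrableOn_compact hK).mono_set hin
  have hsplit : ∫ p in Ioo 0 τ ×ˢ Ioo (-L) L, u p.1 p.2 * (φt (p.1, p.2) + φxx (p.1, p.2)) =
      (∫ p in Ioo 0 τ ×ˢ Ioo (-L) L, Q p) + ∫ p in Ioo 0 τ ×ˢ Ioo (-L) L, P p := by
    rw [← integral_add iQ iP]
    refine integral_congr_ae (ae_of_all _ fun p => ?_)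
    simp only [hQ, hP]
    ring
  have hIQ : ∫ p in Ioo 0 τ ×ˢ Ioo (-L) L, Q p = ∫ x in Ioo (-L) L, u τ x * φ τ x := by
    have hprod : ∫ p in Ioo 0 τ ×ˢ Ioo (-L) L, Q p =
        ∫ x in Ioo (-L) L, ∫ s in Ioo 0 τ, Q (s, x) := by
      rw [IntegrableOn, Measure.volume_eq_prod, ← Measure.prod_restrict] at iQ
      rw [Measure.volume_eq_prod, ← Measure.prod_restrict, integral_prod_symm _ iQ]
    rw [hprod]
    refine setIntegral_congr_fun measurableSet_Ioo fun x hx' => ?_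
    have hxI : x ∈ Icc (-L) L := Ioo_subset_Icc_self hx'
    have maps : MapsTo (fun s : ℝ => (s, x)) (Icc 0 τ) (Icc 0 τ ×ˢ Icc (-L) L) :=
      fun s hs => ⟨hs, hxI⟩
    have := intervalIntegral.integral_eq_sub_of_hasDerivAt_of_le (f := fun s => u s x * φ s x)
      (f' := fun s => Q (s, x)) hτ.1
      ((hu'.mul cφ.continuousOn).comp (by fun_prop : Continuous fun s : ℝ => (s, x)).continuousOn
        maps)
      (fun s hs => by
        have hs' : s ∈ Ioo 0 T := ⟨hs.1, hs.2.trans_le hτ.2⟩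
        exact (ht s hs' x hxI).mul (dt s x))
      (ContinuousOn.intervalIntegrable_of_Icc hτ.1
        (cQ.comp (by fun_prop : Continuous fun s : ℝ => (s, x)).continuousOn maps))
    rw [intervalIntegral.integral_of_le hτ.1, integral_Ioc_eq_integral_Ioo] at this
    simp only [this, h0 x hxI]
    ring
  have hIP : ∫ p in Ioo 0 τ ×ˢ Ioo (-L) L, P p =
      ∫ t in Ioo 0 τ, (u t L * φx (t, L) - u t (-L) * φx (t, -L)) := by
    rw [Measure.volume_eq_prod, setIntegral_prod _ (by rwa [← Measure.volume_eq_prod])]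
    refine setIntegral_congr_fun measurableSet_Ioo fun s hs => ?_
    have hs' : s ∈ Ioo 0 T := ⟨hs.1, hs.2.trans_le hτ.2⟩
    have hsI : s ∈ Icc 0 τ := Ioo_subset_Icc_self hs
    have maps : MapsTo (fun x : ℝ => (s, x)) (Icc (-L) L) (Icc 0 τ ×ˢ Icc (-L) L) :=
      fun x hx => ⟨hsI, hx⟩
    have hder : ∀ x ∈ Icc (-L) L,
        HasDerivAt (fun x => u s x * φx (s, x) - ux s x * φ s x) (P (s, x)) x := by
      intro x hxI
      have := ((hx s hs' x hxI).mul (dxx s x)).sub ((hxx s hs' x hxI).mul (dx s x))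
      refine this.congr_deriv ?_
      simp only [hP]
      ring
    have := intervalIntegral.integral_eq_sub_of_hasDerivAt_of_le hLL
      (fun x hxI => (hder x hxI).continuousAt.continuousWithinAt)
      (fun x hxI => hder x (Ioo_subset_Icc_self hxI))
      (ContinuousOn.intervalIntegrable_of_Icc hLL
        (cP.comp (by fun_prop : Continuous fun x : ℝ => (s, x)).continuousOn maps))
    rw [intervalIntegral.integral_of_le hLL, integral_Ioc_eq_integral_Ioo] at this
    simp only [this, (hb s hsI).1, (hb s hsI).2]
    ring
  rw [hsplit, hIQ, hIP, add_assoc]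
  have hneg : ∫ t in Ioo 0 τ, (u t L * φx (t, L) - u t (-L) * φx (t, -L)) =
      -∫ t in Ioo 0 τ, (u t (-L) * φx (t, -L) - u t L * φx (t, L)) := by
    rw [← integral_neg]
    refine integral_congr_ae (ae_of_all _ fun t => ?_)
    simp
  rw [hneg]
  ring

/-- Bounded measurable functions on sets of finite measure are integrable. -/
theorem integrableOn_of_bounded {X : Type*} [MeasurableSpace X] {μ : Measure X} {s : Set X}
    (hs : MeasurableSet s) (hμ : μ s < ⊤) {f : X → ℂ} (hf : AEStronglyMeasurable f (μ.restrict s))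
    {C : ℝ} (hC : ∀ x ∈ s, ‖f x‖ ≤ C) : IntegrableOn f s μ :=
  haveI : IsFiniteMeasure (μ.restrict s) := ⟨by simpa using hμ⟩
  Integrable.of_bound hf C ((ae_restrict_iff' hs).2 (ae_of_all _ hC))

theorem exists_test_bound (L τ : ℝ) {f : ℝ × ℝ → ℂ} (hf : Continuous f) :
    ∃ C, ∀ t ∈ Icc 0 τ, ∀ x ∈ Icc (-L) L, ‖f (t, x)‖ ≤ C := by
  obtain ⟨C, hC⟩ := ((isCompact_Icc (a := (0 : ℝ)) (b := τ)).prod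
    (isCompact_Icc (a := -L) (b := L))).exists_bound_of_continuousOn hf.continuousOn
  exact ⟨C, fun t ht x hx => hC (t, x) ⟨ht, hx⟩⟩

/-- A family of solutions with a uniform integrable bound can be integrated. -/
theorem BoundedWeakSolution.of_superposition {L T : ℝ} {Ω : Type*} [MeasurableSpace Ω]
    {ν : Measure Ω} [SFinite ν] (hL : 0 < L) {U : Ω → ℝ → ℝ → ℂ}
    (hU : Measurable fun q : Ω × ℝ × ℝ => U q.1 q.2.1 q.2.2) {g : Ω → ℝ} (hg : Integrable g ν)
    (hUg : ∀ᵐ θ ∂ν, ∀ s ∈ Icc 0 T, ∀ x ∈ Icc (-L) L, ‖U θ s x‖ ≤ g θ)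
    (hweak : ∀ᵐ θ ∂ν, ∀ τ ∈ Icc (0 : ℝ) T, ∀ φ : ℝ → ℝ → ℂ,
      ContDiff ℝ ∞ (Function.uncurry φ) →
      (∀ t ∈ Icc (0 : ℝ) τ, φ t (-L) = 0 ∧ φ t L = 0) → WeakIdentity L τ (U θ) φ) :
    BoundedWeakSolution L T (fun s x => ∫ θ, U θ s x ∂ν) := by
  have hUi : ∀ s ∈ Icc 0 T, ∀ x ∈ Icc (-L) L, Integrable (fun θ => U θ s x) ν := by
    intro s hs x hx
    refine hg.mono' (hU.comp (by fun_prop : Measurable fun θ : Ω => (θ, s, x))).aestronglyMeasurable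
      ?_
    filter_upwards [hUg] with θ h using h s hs x hx
  refine ⟨?_, ⟨∫ θ, g θ ∂ν, fun s hs x hx => ?_⟩, ?_⟩
  · have : StronglyMeasurable fun q : (ℝ × ℝ) × Ω => U q.2 q.1.1 q.1.2 :=
      (hU.comp (by fun_prop : Measurable fun q : (ℝ × ℝ) × Ω => (q.2, q.1.1, q.1.2))).stronglyMeasurable
    exact this.integral_prod_right.measurable
  · exact norm_integral_le_of_norm_le hg (hUg.mono fun θ h => h s hs x hx)
  intro τ hτ φ hφ hb
  obtain ⟨φt, φx, φxx, ct, cx, cxx, dt, dx, dxx⟩ := exists_partial_derivs hφ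
  have e1 : ∀ t, deriv (φ t) = fun x => φx (t, x) := fun t => funext fun x => (dx t x).deriv
  have e2 : ∀ t x, deriv (fun s => φ s x) t = φt (t, x) := fun t x => (dt t x).deriv
  have e3 : ∀ t x, deriv (fun y => φx (t, y)) x = φxx (t, x) := fun t x => (dxx t x).deriv
  replace hweak := hweak.mono fun θ h => h τ hτ φ hφ hb
  have hLL : -L ≤ L := by linarith
  unfold WeakIdentity at hweak ⊢
  simp only [e1, e2, e3] at hweak ⊢
  -- One integrability statement for the three domains of the identity: `a` embeds the slice at time
  -- `τ`, the space-time box, or a lateral side into space-time, and `f` is the test factor there.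
  have fubini : ∀ {X : Type} [MeasurableSpace X] (μ : Measure X) [SFinite μ] (S : Set X)
      (_ : MeasurableSet S) (_ : μ S < ⊤) (a : X → ℝ × ℝ) (f : X → ℂ) (C : ℝ)
      (_ : Measurable a) (_ : Measurable f)
      (_ : ∀ x ∈ S, (a x).1 ∈ Icc 0 T ∧ (a x).2 ∈ Icc (-L) L ∧ ‖f x‖ ≤ C),
      Integrable (fun q : X × Ω => U q.2 (a q.1).1 (a q.1).2 * f q.1) ((μ.restrict S).prod ν) := by
    intro X _ μ _ S hS hμ a f C ha hf h
    have hfin : IsFiniteMeasure (μ.restrict S) := ⟨by simpa using hμ⟩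
    refine Integrable.mono' (g := fun q : X × Ω => C * g q.2) ?_ ?_ ?_
    · exact (integrable_const C).mul_prod hg
    · refine Measurable.aestronglyMeasurable ?_
      refine Measurable.mul ?_ (hf.comp measurable_fst)
      exact hU.comp (by fun_prop :
        Measurable fun q : X × Ω => (q.2, (a q.1).1, (a q.1).2))
    · have h1 : ∀ᵐ q ∂((μ.restrict S).prod ν), q.1 ∈ S :=
        Measure.quasiMeasurePreserving_fst.ae (ae_restrict_mem hS)
      have h2 : ∀ᵐ q ∂((μ.restrict S).prod ν),
          ∀ s ∈ Icc 0 T, ∀ x ∈ Icc (-L) L, ‖U q.2 s x‖ ≤ g q.2 :=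
        Measure.quasiMeasurePreserving_snd.ae hUg
      filter_upwards [h1, h2] with q hq1 hq2
      obtain ⟨ha1, ha2, hf1⟩ := h q.1 hq1
      have hh := hq2 _ ha1 _ ha2
      rw [norm_mul, mul_comm]
      exact mul_le_mul hf1 hh (norm_nonneg _) ((norm_nonneg _).trans hf1)
  have cφ : Continuous (Function.uncurry φ) := hφ.continuous
  obtain ⟨C1, hC1⟩ := exists_test_bound L τ cφ
  obtain ⟨C2, hC2⟩ := exists_test_bound L τ (ct.add cxx)
  obtain ⟨C3, hC3⟩ := exists_test_bound L τ cx
  have hR : (volume : Measure (ℝ × ℝ)) (Ioo 0 τ ×ˢ Ioo (-L) L) < ⊤ := by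
    rw [Measure.volume_eq_prod, Measure.prod_prod]
    exact ENNReal.mul_lt_top (by simp) (by simp)
  have hτI : ∀ {t}, t ∈ Ioo 0 τ → t ∈ Icc 0 T := fun ht => ⟨ht.1.le, ht.2.le.trans hτ.2⟩
  have F1 := fubini volume (Ioo (-L) L) measurableSet_Ioo (by simp) (fun x => (τ, x))
    (fun x => φ τ x) C1 (by fun_prop) (cφ.comp (by fun_prop : Continuous fun x : ℝ => (τ, x))).measurable
    (fun x hx => ⟨hτ, Ioo_subset_Icc_self hx, hC1 τ ⟨hτ.1, le_rfl⟩ x (Ioo_subset_Icc_self hx)⟩)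
  have F2 := fubini volume (Ioo 0 τ ×ˢ Ioo (-L) L) (measurableSet_Ioo.prod measurableSet_Ioo) hR
    id (fun p => φt (p.1, p.2) + φxx (p.1, p.2)) C2 measurable_id (ct.add cxx).measurable
    (fun p hp => ⟨hτI hp.1, Ioo_subset_Icc_self hp.2,
      hC2 p.1 (Ioo_subset_Icc_self hp.1) p.2 (Ioo_subset_Icc_self hp.2)⟩)
  have F3 := fubini volume (Ioo 0 τ) measurableSet_Ioo (by simp) (fun t => (t, -L))
    (fun t => φx (t, -L)) C3 (by fun_prop)
    (cx.comp (by fun_prop : Continuous fun t : ℝ => (t, -L))).measurable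
    (fun t ht => ⟨hτI ht, left_mem_Icc.2 hLL,
      hC3 t (Ioo_subset_Icc_self ht) _ (left_mem_Icc.2 hLL)⟩)
  have F4 := fubini volume (Ioo 0 τ) measurableSet_Ioo (by simp) (fun t => (t, L))
    (fun t => φx (t, L)) C3 (by fun_prop)
    (cx.comp (by fun_prop : Continuous fun t : ℝ => (t, L))).measurable
    (fun t ht => ⟨hτI ht, right_mem_Icc.2 hLL,
      hC3 t (Ioo_subset_Icc_self ht) _ (right_mem_Icc.2 hLL)⟩)
  have F34 := F3.sub F4
  simp only [id] at F2
  have G34 : ∫ t in Ioo 0 τ, ((∫ θ, U θ t (-L) ∂ν) * φx (t, -L) - (∫ θ, U θ t L ∂ν) * φx (t, L)) =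
      ∫ t in Ioo 0 τ, ∫ θ, (U θ t (-L) * φx (t, -L) - U θ t L * φx (t, L)) ∂ν := by
    refine setIntegral_congr_fun measurableSet_Ioo fun t ht => ?_
    rw [integral_sub ((hUi t (hτI ht) _ (left_mem_Icc.2 hLL)).mul_const _)
      ((hUi t (hτI ht) _ (right_mem_Icc.2 hLL)).mul_const _), integral_mul_const,
      integral_mul_const]
  rw [G34]
  simp only [← integral_mul_const]
  have S1 := integral_integral_swap (f := fun x θ => U θ τ x * φ τ x) F1
  have S2 := integral_integral_swap (f := fun (p : ℝ × ℝ) θ =>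
    U θ p.1 p.2 * (φt (p.1, p.2) + φxx (p.1, p.2))) F2
  have S3 := integral_integral_swap
    (f := fun t θ => U θ t (-L) * φx (t, -L) - U θ t L * φx (t, L)) F34
  rw [S1, S2, S3]
  exact (integral_congr_ae hweak).trans
    (integral_add F2.integral_prod_right F34.integral_prod_right)

/-- A sum of two solutions is the superposition over `Bool` with counting measure. -/
theorem BoundedWeakSolution.add {L T : ℝ} (hL : 0 < L) {u v : ℝ → ℝ → ℂ}
    (hu : BoundedWeakSolution L T u) (hv : BoundedWeakSolution L T v) :
    BoundedWeakSolution L T (fun s x => u s x + v s x) := by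
  obtain ⟨Cu, hCu⟩ := hu.bounded
  obtain ⟨Cv, hCv⟩ := hv.bounded
  have h := BoundedWeakSolution.of_superposition (L := L) (T := T) (Ω := Bool)
    (ν := Measure.count) hL
    (U := fun b : Bool => bif b then u else v) (g := fun b => bif b then Cu else Cv)
    (measurable_from_prod_countable_right fun b => by
      cases b
      · exact hv.measurable
      · exact hu.measurable) (.of_finite)
    (ae_of_all _ fun b => by cases b; exacts [hCv, hCu])
    (ae_of_all _ fun b => by cases b; exacts [hv.weak, hu.weak])
  simpa [integral_count, Fintype.sum_bool] using h

theorem BoundedWeakSolution.mem_reachableSet {L T : ℝ} (hL : 0 < L)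
    {u : ℝ → ℝ → ℂ} (hu : BoundedWeakSolution L T u) {w : ℝ → ℂ}
    (hw : ∀ x ∈ Ioo (-L) L, u T x = w x) : w ∈ reachableSet L T := by
  obtain ⟨C, hC⟩ := hu.bounded
  have hLL : -L ≤ L := by linarith
  have sec : ∀ x, Measurable fun t => u t x := fun x =>
    hu.measurable.comp (by fun_prop : Measurable fun t : ℝ => (t, x))
  have sec' : ∀ t, Measurable (u t) := fun t =>
    hu.measurable.comp (by fun_prop : Measurable fun x : ℝ => (t, x))
  have memb : ∀ x ∈ Icc (-L) L, MemLp (fun t => u t x) 2 (volume.restrict (Ioo 0 T)) := by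
    intro x hx
    refine MemLp.of_bound (sec x).aestronglyMeasurable C ?_
    filter_upwards [ae_restrict_mem measurableSet_Ioo] with t ht
    exact hC t (Ioo_subset_Icc_self ht) x hx
  refine ⟨fun t => u t (-L), fun t => u t L, u, memb _ (left_mem_Icc.2 hLL),
    memb _ (right_mem_Icc.2 hLL), ⟨?_, fun τ hτ φ hφ hb => ⟨?_, hu.weak τ hτ φ hφ hb⟩⟩, ?_⟩
  · have : IsFiniteMeasure ((volume : Measure (ℝ × ℝ)).restrict (Ioo 0 T ×ˢ Ioo (-L) L)) := by
      rw [Measure.volume_eq_prod, ← Measure.prod_restrict]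
      infer_instance
    refine MemLp.of_bound hu.measurable.aestronglyMeasurable C ?_
    filter_upwards [ae_restrict_mem (measurableSet_Ioo.prod measurableSet_Ioo)] with p hp
    exact hC _ (Ioo_subset_Icc_self hp.1) _ (Ioo_subset_Icc_self hp.2)
  · obtain ⟨D, hD⟩ := exists_test_bound L τ hφ.continuous
    refine integrableOn_of_bounded (C := C * D) measurableSet_Ioo (by simp) ?_ ?_
    · exact ((sec' τ).mul (hφ.continuous.comp
        (by fun_prop : Continuous fun x : ℝ => (τ, x))).measurable).aestronglyMeasurable
    · intro x hx
      have hx' := Ioo_subset_Icc_self hx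
      rw [norm_mul]
      exact mul_le_mul (hC τ hτ x hx') (hD τ ⟨hτ.1, le_rfl⟩ x hx') (norm_nonneg _)
        ((norm_nonneg _).trans (hC τ hτ x hx'))
  · filter_upwards [ae_restrict_mem measurableSet_Ioo] with x hx using hw x hx

/-- `w` is the final state of a bounded solution. -/
def BddReachable (L T : ℝ) (w : ℝ → ℂ) : Prop :=
  ∃ u, BoundedWeakSolution L T u ∧ ∀ x ∈ Ioo (-L) L, u T x = w x

theorem BddReachable.add {L T : ℝ} (hL : 0 < L) {v w : ℝ → ℂ} (hv : BddReachable L T v)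
    (hw : BddReachable L T w) : BddReachable L T (fun x => v x + w x) := by
  obtain ⟨u₁, h₁, e₁⟩ := hv
  obtain ⟨u₂, h₂, e₂⟩ := hw
  exact ⟨_, h₁.add hL h₂, fun x hx => by rw [e₁ x hx, e₂ x hx]⟩

theorem BddReachable.congr {L T : ℝ} {v w : ℝ → ℂ} (hv : BddReachable L T v)
    (h : ∀ x ∈ Ioo (-L) L, v x = w x) : BddReachable L T w := by
  obtain ⟨u, h₁, e₁⟩ := hv
  exact ⟨u, h₁, fun x hx => (e₁ x hx).trans (h x hx)⟩

theorem BddReachable.mem_reachableSet {L T : ℝ} (hL : 0 < L) {w : ℝ → ℂ}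
    (hw : BddReachable L T w) : w ∈ reachableSet L T := by
  obtain ⟨u, h, e⟩ := hw
  exact h.mem_reachableSet hL e

/-- The final state of a classical solution that starts from zero is reachable. -/
theorem bddReachable_of_classical {L T : ℝ} (hL : 0 < L) (hT : 0 < T) {u ut ux : ℝ → ℝ → ℂ}
    (hu : ContinuousOn (Function.uncurry u) (Icc 0 T ×ˢ Icc (-L) L))
    (hut : ContinuousOn (Function.uncurry ut) (Icc 0 T ×ˢ Icc (-L) L))
    (ht : ∀ s ∈ Ioo 0 T, ∀ x ∈ Icc (-L) L, HasDerivAt (fun r => u r x) (ut s x) s)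
    (hx : ∀ s ∈ Ioo 0 T, ∀ x ∈ Icc (-L) L, HasDerivAt (u s) (ux s x) x)
    (hxx : ∀ s ∈ Ioo 0 T, ∀ x ∈ Icc (-L) L, HasDerivAt (ux s) (ut s x) x)
    (h0 : ∀ x ∈ Icc (-L) L, u 0 x = 0) : BddReachable L T (u T) := by
  classical
  have hmeas : MeasurableSet (Icc 0 T ×ˢ Icc (-L) L) := measurableSet_Icc.prod measurableSet_Icc
  have hLL : -L ≤ L := by linarith
  -- `u` is controlled only on the closed box; its extension by zero is measurable on the whole
  -- plane.
  set v : ℝ → ℝ → ℂ := fun s x =>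
    (Icc 0 T ×ˢ Icc (-L) L).piecewise (Function.uncurry u) 0 (s, x) with hv
  have hvu : ∀ s ∈ Icc 0 T, ∀ x ∈ Icc (-L) L, v s x = u s x := fun s hs x hx => by
    have hmem : (s, x) ∈ Icc 0 T ×ˢ Icc (-L) L := ⟨hs, hx⟩
    simp only [hv, piecewise_eq_of_mem _ _ _ hmem, Function.uncurry_apply_pair]
  refine ⟨v, ⟨?_, ?_, ?_⟩, fun x hx =>
    hvu T (right_mem_Icc.2 hT.le) x (Ioo_subset_Icc_self hx)⟩
  · exact hu.measurable_piecewise continuousOn_const hmeas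
  · obtain ⟨C, hC⟩ := ((isCompact_Icc (a := (0 : ℝ)) (b := T)).prod
      (isCompact_Icc (a := -L) (b := L))).exists_bound_of_continuousOn hu
    refine ⟨C, fun s hs x hx => ?_⟩
    rw [hvu s hs x hx]
    exact hC (s, x) ⟨hs, hx⟩
  · intro τ hτ φ hφ hb
    have h := weakIdentity_of_classical hL hu hut ht hx hxx h0 hτ hφ hb
    have hτI : ∀ {t}, t ∈ Ioo 0 τ → t ∈ Icc 0 T := fun ht => ⟨ht.1.le, ht.2.le.trans hτ.2⟩
    unfold WeakIdentity at h ⊢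
    convert h using 1
    · exact setIntegral_congr_fun measurableSet_Ioo fun x hx => by
        simp only [hvu τ hτ x (Ioo_subset_Icc_self hx)]
    · congr 1
      · exact setIntegral_congr_fun (measurableSet_Ioo.prod measurableSet_Ioo) fun p hp => by
          simp only [hvu p.1 (hτI hp.1) p.2 (Ioo_subset_Icc_self hp.2)]
      · exact setIntegral_congr_fun measurableSet_Ioo fun t ht => by
          simp only [hvu t (hτI ht) _ (left_mem_Icc.2 hLL), hvu t (hτI ht) _ (right_mem_Icc.2 hLL)]

/-! ### Gevrey functions of order two -/

/-- The successive derivatives of a product, from those of the factors. -/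
def jetMul (X Y : ℕ → ℝ → ℂ) (n : ℕ) (s : ℝ) : ℂ :=
  ∑ ij ∈ Finset.HasAntidiagonal.antidiagonal n, (n.choose ij.1 : ℂ) * (X ij.1 s * Y ij.2 s)

theorem hasDerivAt_jetMul {X Y : ℕ → ℝ → ℂ} {s : ℝ}
    (hX : ∀ n, HasDerivAt (X n) (X (n + 1) s) s) (hY : ∀ n, HasDerivAt (Y n) (Y (n + 1) s) s)
    (n : ℕ) : HasDerivAt (jetMul X Y n) (jetMul X Y (n + 1) s) s := by
  have h : HasDerivAt (jetMul X Y n) (∑ ij ∈ Finset.HasAntidiagonal.antidiagonal n, (n.choose ij.1 : ℂ) *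
      (X (ij.1 + 1) s * Y ij.2 s + X ij.1 s * Y (ij.2 + 1) s)) s :=
    HasDerivAt.fun_sum fun ij _ => ((hX ij.1).mul (hY ij.2)).const_mul _
  refine h.congr_deriv ?_
  rw [jetMul, Finset.sum_antidiagonal_choose_succ_mul (fun i j => X i s * Y j s) n,
    ← Finset.sum_add_distrib]
  refine Finset.sum_congr rfl fun ij hij => ?_
  have : n.choose ij.2 = n.choose ij.1 :=
    Nat.choose_symm_of_eq_add (by rw [← Finset.HasAntidiagonal.mem_antidiagonal.1 hij, add_comm])
  rw [this]
  ring

/-- Comparing `choose (j + k) j` with `choose (2j + 2k) (2j)` makes the Gevrey weights `(2n)!`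
compatible with the Leibniz rule. -/
theorem choose_mul_factorial_le (j k : ℕ) :
    (j + k).choose j * ((2 * j).factorial * (2 * k).factorial) ≤ (2 * (j + k)).factorial := by
  have h1 : (j + k).choose j ≤ (2 * j + 2 * k).choose (2 * j) := by
    calc (j + k).choose j = (j + k).choose k := by
          rw [← Nat.choose_symm_add]
      _ ≤ (2 * j + k).choose k := Nat.choose_le_choose _ (by omega)
      _ = (2 * j + k).choose (2 * j) := by rw [← Nat.choose_symm_add]
      _ ≤ _ := Nat.choose_le_choose _ (by omega)
  calc _ ≤ (2 * j + 2 * k).choose (2 * j) * ((2 * j).factorial * (2 * k).factorial) :=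
        Nat.mul_le_mul_right _ h1
    _ = _ := by
      rw [← mul_assoc, Nat.choose_symm_add, mul_add]
      exact Nat.add_choose_mul_factorial_mul_factorial _ _

/-- Products preserve Gevrey bounds of order two. -/
theorem norm_jetMul_le {X Y : ℕ → ℝ → ℂ} {s C D ε : ℝ} (hε : 0 ≤ ε)
    (hX : ∀ n, ‖X n s‖ ≤ C * ε ^ n * (2 * n).factorial)
    (hY : ∀ n, ‖Y n s‖ ≤ D * ε ^ n * (2 * n).factorial) (n : ℕ) :
    ‖jetMul X Y n s‖ ≤ C * D * (2 * ε) ^ n * (2 * n).factorial := by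
  have hC : 0 ≤ C := by simpa using (norm_nonneg _).trans (hX 0)
  have hD : 0 ≤ D := by simpa using (norm_nonneg _).trans (hY 0)
  have hterm : ∀ ij ∈ Finset.HasAntidiagonal.antidiagonal n, ‖(n.choose ij.1 : ℂ) * (X ij.1 s * Y ij.2 s)‖ ≤
      C * D * ε ^ n * (2 * n).factorial := by
    rintro ⟨j, k⟩ hjk
    obtain rfl : j + k = n := Finset.HasAntidiagonal.mem_antidiagonal.1 hjk
    have h := choose_mul_factorial_le j k
    have h' : ((j + k).choose j : ℝ) * ((2 * j).factorial * (2 * k).factorial) ≤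
        (2 * (j + k)).factorial := by exact_mod_cast h
    calc ‖((j + k).choose j : ℂ) * (X j s * Y k s)‖
        = ((j + k).choose j : ℝ) * (‖X j s‖ * ‖Y k s‖) := by
          rw [norm_mul, norm_mul, Complex.norm_natCast]
      _ ≤ ((j + k).choose j : ℝ) *
          ((C * ε ^ j * (2 * j).factorial) * (D * ε ^ k * (2 * k).factorial)) := by
          gcongr
          · exact hX j
          · exact hY k
      _ = C * D * ε ^ (j + k) *
          (((j + k).choose j : ℝ) * ((2 * j).factorial * (2 * k).factorial)) := by
          rw [pow_add]; ring
      _ ≤ _ := by gcongr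
  calc ‖jetMul X Y n s‖ ≤ ∑ ij ∈ Finset.HasAntidiagonal.antidiagonal n, C * D * ε ^ n * (2 * n).factorial :=
        norm_sum_le_of_le _ hterm
    _ = (n + 1 : ℕ) * (C * D * ε ^ n * (2 * n).factorial) := by
        rw [Finset.sum_const, Finset.Nat.card_antidiagonal, nsmul_eq_mul]
    -- The `n + 1` terms of the Leibniz sum are absorbed by `2 ^ n`; this is why the rate doubles.
    _ ≤ (2 ^ n : ℕ) * (C * D * ε ^ n * (2 * n).factorial) := by
        gcongr
        exact Nat.lt_two_pow_self
    _ = _ := by push_cast; rw [mul_pow]; ring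

/-- Keep the single term `(a / s) ^ (n + k) / (n + k)!` of the series of `exp (a / s)`. The spare
`k` powers of `s` measure the flatness at `s = 0`. -/
theorem pow_mul_exp_neg_le {a : ℝ} (ha : 0 < a) (n k : ℕ) {s : ℝ} (hs : 0 < s) :
    Real.exp (-(a / s)) / s ^ n ≤ (n + k).factorial / a ^ (n + k) * s ^ k := by
  have h := Real.pow_div_factorial_le_exp (a / s) (by positivity) (n + k)
  have hf : (0 : ℝ) < (n + k).factorial := by positivity
  rw [div_le_iff₀ hf, div_pow, div_le_iff₀ (by positivity)] at h
  rw [Real.exp_neg, div_le_iff₀ (by positivity), inv_le_iff_one_le_mul₀ (Real.exp_pos _)]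
  have e : ((n + k).factorial / a ^ (n + k) * s ^ k * s ^ n) * Real.exp (a / s) =
      (Real.exp (a / s) * (n + k).factorial * s ^ (n + k)) / a ^ (n + k) := by
    rw [pow_add s]; field_simp
  rw [mul_comm, mul_comm (Real.exp _), e]
  rwa [one_le_div (by positivity)]

/-- The successive derivatives of `exp (-M / s)`, extended by zero to `s ≤ 0`. -/
def flatJet (M : ℝ) (n : ℕ) (s : ℝ) : ℂ :=
  if 0 < s then iteratedDeriv n (fun w : ℂ => Complex.exp (-M / w)) s else 0

theorem differentiableOn_exp_neg_div (M : ℝ) :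
    DifferentiableOn ℂ (fun w : ℂ => Complex.exp (-M / w)) {0}ᶜ := by
  intro w hw
  have hw : w ≠ 0 := hw
  exact DifferentiableAt.differentiableWithinAt (by fun_prop (disch := assumption))

/-- Cauchy's estimate on the circle of centre `s` and radius `s / 2`. There `Re w ≥ s / 2` and `‖w‖
≤ 3s / 2`, so `Re (1 / w) = Re w / ‖w‖² ≥ 2 / (9s)`. -/
theorem norm_flatJet_le_exp {M : ℝ} (hM : 0 < M) (n : ℕ) {s : ℝ} (hs : 0 < s) :
    ‖flatJet M n s‖ ≤ n.factorial * 2 ^ n * (Real.exp (-((2 * M / 9) / s)) / s ^ n) := by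
  rw [flatJet, if_pos hs]
  have hs2 : 0 < s / 2 := by positivity
  have hre : ∀ w ∈ Metric.closedBall (s : ℂ) (s / 2), s / 2 ≤ w.re := by
    intro w hw
    rw [Metric.mem_closedBall, dist_eq_norm] at hw
    have := (Complex.abs_re_le_norm (w - s)).trans hw
    rw [Complex.sub_re, Complex.ofReal_re, abs_le] at this
    linarith [this.1]
  have hsub : Metric.closedBall (s : ℂ) (s / 2) ⊆ {0}ᶜ := by
    intro w hw h0
    have := hre w hw
    rw [mem_singleton_iff.1 h0, Complex.zero_re] at this
    linarith
  have h := Complex.norm_iteratedDeriv_le_of_forall_mem_sphere_norm_le n hs2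
    (f := fun w : ℂ => Complex.exp (-M / w)) (c := s) (C := Real.exp (-((2 * M / 9) / s)))
    (((differentiableOn_exp_neg_div M).mono hsub).diffContOnCl_ball subset_rfl) ?_
  · refine h.trans (le_of_eq ?_)
    rw [div_pow]
    field_simp
  · intro w hw
    have hw1 := hre w (Metric.sphere_subset_closedBall hw)
    have hw2 : ‖w‖ ≤ 3 * s / 2 := by
      rw [mem_sphere_iff_norm] at hw
      calc ‖w‖ = ‖(w - s) + s‖ := by rw [sub_add_cancel]
        _ ≤ ‖w - s‖ + ‖(s : ℂ)‖ := norm_add_le _ _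
        _ = 3 * s / 2 := by rw [hw, Complex.norm_real, Real.norm_of_nonneg hs.le]; ring
    have hw0 : 0 < ‖w‖ := by
      have := (Complex.re_le_norm w)
      linarith
    rw [Complex.norm_exp]
    apply Real.exp_le_exp.2
    have e : (-(M : ℂ) / w).re = -(M * (w.re / ‖w‖ ^ 2)) := by
      rw [neg_div, Complex.neg_re, div_eq_mul_inv, Complex.re_ofReal_mul, Complex.inv_re,
        Complex.normSq_eq_norm_sq]
    rw [e, neg_le_neg_iff, mul_comm 2 M, mul_div_assoc, mul_div_assoc]
    refine mul_le_mul_of_nonneg_left ?_ hM.le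
    rw [le_div_iff₀ (by positivity), div_mul_eq_mul_div, div_le_iff₀ hs]
    nlinarith [mul_self_le_mul_self (norm_nonneg w) hw2]

/-- Gevrey order two: one `n!` comes from Cauchy's estimate, another from `exp (-a / s) / sⁿ ≤ n! /
aⁿ`, and `n!² ≤ (2n)!`. The rate `9 / M` is as small as desired for large `M`. -/
theorem norm_flatJet_le {M : ℝ} (hM : 0 < M) (n : ℕ) (s : ℝ) :
    ‖flatJet M n s‖ ≤ 1 * (9 / M) ^ n * (2 * n).factorial := by
  rcases lt_or_ge 0 s with hs | hs
  · refine (norm_flatJet_le_exp hM n hs).trans ?_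
    have h := pow_mul_exp_neg_le (a := 2 * M / 9) (by positivity) n 0 hs
    have hf : (n.factorial * n.factorial : ℝ) ≤ (2 * n).factorial := by
      have := Nat.le_of_dvd (Nat.factorial_pos _) (Nat.factorial_mul_factorial_dvd_factorial_add n n)
      rw [← two_mul] at this
      exact_mod_cast this
    calc _ ≤ n.factorial * 2 ^ n * ((n + 0).factorial / (2 * M / 9) ^ (n + 0) * s ^ 0) := by gcongr
      _ = (9 / M) ^ n * (n.factorial * n.factorial) := by
          simp only [add_zero, pow_zero, div_pow, mul_pow]
          field_simp
      _ ≤ (9 / M) ^ n * (2 * n).factorial := by gcongr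
      _ = _ := by ring
  · rw [flatJet, if_neg hs.not_gt, norm_zero]
    positivity

theorem flatJet_of_nonpos (M : ℝ) (n : ℕ) {s : ℝ} (hs : s ≤ 0) : flatJet M n s = 0 :=
  if_neg hs.not_gt

theorem hasDerivAt_flatJet {M : ℝ} (hM : 0 < M) (n : ℕ) (s : ℝ) :
    HasDerivAt (flatJet M n) (flatJet M (n + 1) s) s := by
  rcases lt_trichotomy 0 s with hs | rfl | hs
  · have hd : DifferentiableAt ℂ (iteratedDeriv n (fun w : ℂ => Complex.exp (-M / w))) s := by
      have := ((differentiableOn_exp_neg_div M).analyticOnNhd isOpen_compl_singleton).iterated_deriv n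
      rw [← iteratedDeriv_eq_iterate] at this
      exact (this s (by simpa using hs.ne')).differentiableAt
    have h1 := hd.hasDerivAt.comp_ofReal
    rw [← iteratedDeriv_succ] at h1
    rw [flatJet, if_pos hs]
    refine h1.congr_of_eventuallyEq ?_
    filter_upwards [lt_mem_nhds hs] with r hr
    rw [flatJet, if_pos hr]
  · rw [flatJet_of_nonpos M _ le_rfl]
    -- Quadratic vanishing at the junction `s = 0` makes the derivative zero there.
    have hO : flatJet M n =O[nhds 0] fun x : ℝ => ‖x - 0‖ ^ 2 := by
      refine Asymptotics.IsBigO.of_bound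
        (n.factorial * 2 ^ n * ((n + 2).factorial / (2 * M / 9) ^ (n + 2))) ?_
      refine Filter.Eventually.of_forall fun x => ?_
      rcases lt_or_ge 0 x with hx | hx
      · refine (norm_flatJet_le_exp hM n hx).trans ?_
        have h := pow_mul_exp_neg_le (a := 2 * M / 9) (by positivity) n 2 hx
        calc _ ≤ n.factorial * 2 ^ n * ((n + 2).factorial / (2 * M / 9) ^ (n + 2) * x ^ 2) := by
              gcongr
          _ = _ := by simp [mul_assoc]
      · rw [flatJet_of_nonpos M _ hx, norm_zero]
        positivity
    simpa using (hO.hasFDerivAt one_lt_two).hasDerivAt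
  · rw [flatJet_of_nonpos M _ hs.le]
    refine (hasDerivAt_const s (0 : ℂ)).congr_of_eventuallyEq ?_
    filter_upwards [gt_mem_nhds hs] with r hr
    exact flatJet_of_nonpos M _ hr.le

/-- The successive derivatives of a smooth step from `0` to `1` on `[0, T]`, with Gevrey bounds of
order two and arbitrarily small rate. -/
theorem exists_gevrey_step {ε T : ℝ} (hε : 0 < ε) (hT : 0 < T) :
    ∃ (X : ℕ → ℝ → ℂ) (C : ℝ), (∀ n s, HasDerivAt (X n) (X (n + 1) s) s) ∧
      (∀ n, ∀ s ≤ 0, X n s = 0) ∧ X 0 T = 1 ∧ (∀ n, X (n + 1) T = 0) ∧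
      ∀ n, ∀ s ∈ Icc 0 T, ‖X n s‖ ≤ C * ε ^ n * (2 * n).factorial := by
  -- Each factor `exp (-M / s)`, `exp (-M / (T - s))` then has rate `9 / M = ε / 2`, and their
  -- product has rate `ε`.
  set M : ℝ := 18 / ε with hMdef
  have hM : 0 < M := by positivity
  have hMε : 9 / M = ε / 2 := by rw [hMdef]; field_simp; norm_num
  set Y : ℕ → ℝ → ℂ := fun n s => (-1) ^ n * flatJet M n (T - s) with hY
  have dY : ∀ n s, HasDerivAt (Y n) (Y (n + 1) s) s := by
    intro n s
    have h := ((hasDerivAt_flatJet hM n (T - s)).scomp s ((hasDerivAt_id s).const_sub T)).const_mul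
      ((-1 : ℂ) ^ n)
    refine h.congr_deriv ?_
    simp only [hY, pow_succ]
    simp
  set b : ℕ → ℝ → ℂ := jetMul (flatJet M) Y with hb
  have db : ∀ n s, HasDerivAt (b n) (b (n + 1) s) s := fun n s =>
    hasDerivAt_jetMul (fun k => hasDerivAt_flatJet hM k s) (fun k => dY k s) n
  have cb : ∀ n, Continuous (b n) := fun n =>
    continuous_iff_continuousAt.2 fun s => (db n s).continuousAt
  have nb : ∀ n s, ‖b n s‖ ≤ ε ^ n * (2 * n).factorial := by
    intro n s
    have := norm_jetMul_le (X := flatJet M) (Y := Y) (s := s) (C := 1) (D := 1) (ε := 9 / M)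
      (by positivity) (fun k => norm_flatJet_le hM k s) (fun k => by
        simpa [hY] using norm_flatJet_le hM k (T - s)) n
    rw [hMε] at this
    simpa [hb, mul_div_cancel₀] using this
  have b0 : ∀ n, ∀ s ≤ 0, b n s = 0 := fun n s hs => by
    simp [hb, jetMul, flatJet_of_nonpos M _ hs]
  have bT : ∀ n, b n T = 0 := fun n => by
    simp [hb, jetMul, hY, flatJet_of_nonpos M _ le_rfl]
  set I : ℂ := ∫ s in (0 : ℝ)..T, b 0 s with hI
  have hI0 : I ≠ 0 := by
    have hbr : ∀ s ∈ Ioo 0 T, b 0 s = ((b 0 s).re : ℂ) ∧ 0 < (b 0 s).re := by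
      intro s hs
      have h1 : b 0 s = ((Real.exp (-M / s) * Real.exp (-M / (T - s)) : ℝ) : ℂ) := by
        simp [hb, jetMul, hY, flatJet, hs.1, hs.2]
      rw [h1, Complex.ofReal_re]
      exact ⟨rfl, by positivity⟩
    have h2 : I = ((∫ s in (0 : ℝ)..T, (b 0 s).re : ℝ) : ℂ) := by
      rw [hI, ← intervalIntegral.integral_ofReal, intervalIntegral.integral_of_le hT.le,
        intervalIntegral.integral_of_le hT.le, integral_Ioc_eq_integral_Ioo,
        integral_Ioc_eq_integral_Ioo]
      exact setIntegral_congr_fun measurableSet_Ioo fun s hs => (hbr s hs).1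
    rw [h2]
    have := intervalIntegral.intervalIntegral_pos_of_pos_on
      ((Complex.continuous_re.comp (cb 0)).intervalIntegrable 0 T) (fun s hs => (hbr s hs).2) hT
    exact_mod_cast this.ne'
  -- The step is the normalized primitive of the bump `b 0`, so its derivatives are those of the
  -- bump with the index lowered by one. This shift costs the factor `1 / ε` in the final constant;
  -- `C₀` covers index zero.
  set X : ℕ → ℝ → ℂ := fun n s =>
    Nat.casesOn n ((∫ r in (0 : ℝ)..s, b 0 r) / I) fun m => b m s / I with hX
  have dX : ∀ n s, HasDerivAt (X n) (X (n + 1) s) s := by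
    intro n s
    cases n with
    | zero => exact ((cb 0).integral_hasStrictDerivAt 0 s).hasDerivAt.div_const I
    | succ m => exact (db m s).div_const I
  obtain ⟨C₀, hC₀⟩ := isCompact_Icc.exists_bound_of_continuousOn
    (s := Icc 0 T) (f := X 0) fun s _ => (dX 0 s).continuousAt.continuousWithinAt
  have hC₀' : 0 ≤ C₀ := (norm_nonneg _).trans (hC₀ 0 (left_mem_Icc.2 hT.le))
  refine ⟨X, C₀ + 1 / (‖I‖ * ε), dX, ?_, div_self hI0, fun n => by simp [hX, bT], ?_⟩
  · intro n s hs
    cases n with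
    | zero =>
      have : ∫ r in (0 : ℝ)..s, b 0 r = 0 := by
        rw [intervalIntegral.integral_symm, intervalIntegral.integral_of_le hs,
          setIntegral_congr_fun measurableSet_Ioc fun r hr => b0 0 r hr.2]
        simp
      change (∫ r in (0 : ℝ)..s, b 0 r) / I = 0
      rw [this, zero_div]
    | succ m => simp [hX, b0 m s hs]
  · intro n s hs
    have hIn : 0 < ‖I‖ := norm_pos_iff.2 hI0
    cases n with
    | zero =>
      refine (hC₀ s hs).trans ?_
      have : 0 ≤ 1 / (‖I‖ * ε) := by positivity
      simpa using this
    | succ m =>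
      have hf : ((2 * m).factorial : ℝ) ≤ (2 * (m + 1)).factorial := by
        exact_mod_cast Nat.factorial_le (by omega)
      calc ‖X (m + 1) s‖ = ‖b m s‖ / ‖I‖ := by simp [hX]
        _ ≤ (ε ^ m * (2 * m).factorial) / ‖I‖ := by gcongr; exact nb m s
        _ ≤ (ε ^ m * (2 * (m + 1)).factorial) / ‖I‖ := by gcongr
        _ = (0 + 1 / (‖I‖ * ε)) * ε ^ (m + 1) * (2 * (m + 1)).factorial := by
            rw [pow_succ]; field_simp; ring
        _ ≤ _ := by gcongr

/-! ### Power series in space and null controllability by flatness -/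

/-- The exponential generating function of `b`. -/
def egf (b : ℕ → ℂ) (x : ℝ) : ℂ := ∑' n, b n * ((x : ℂ) ^ n / n.factorial)

theorem norm_egf_term_le {b : ℕ → ℂ} {ρ D : ℝ} (hρ : 0 < ρ)
    (hb : ∀ n, ‖b n‖ * ρ ^ n ≤ D * n.factorial) {x r : ℝ} (hx : |x| ≤ r) (n : ℕ) :
    ‖b n * ((x : ℂ) ^ n / n.factorial)‖ ≤ D * (r / ρ) ^ n := by
  have hf : (0 : ℝ) < n.factorial := by positivity
  have h := hb n
  rw [← le_div_iff₀ (by positivity)] at h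
  have hr : 0 ≤ r := (abs_nonneg x).trans hx
  rw [norm_mul, norm_div, norm_pow, Complex.norm_real, Real.norm_eq_abs, Complex.norm_natCast]
  calc ‖b n‖ * (|x| ^ n / n.factorial) ≤ (D * n.factorial / ρ ^ n) * (r ^ n / n.factorial) := by
        gcongr
        exact (norm_nonneg _).trans h
    _ = _ := by rw [div_pow]; field_simp

theorem egf_bound_nonneg {b : ℕ → ℂ} {ρ D : ℝ} (hb : ∀ n, ‖b n‖ * ρ ^ n ≤ D * n.factorial) :
    0 ≤ D := by simpa using (norm_nonneg _).trans (by simpa using hb 0)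

theorem norm_egf_le {b : ℕ → ℂ} {ρ D : ℝ} (hρ : 0 < ρ)
    (hb : ∀ n, ‖b n‖ * ρ ^ n ≤ D * n.factorial) {x : ℝ} (hx : |x| ≤ ρ / 2) :
    ‖egf b x‖ ≤ D * 2 := by
  have h := norm_egf_term_le hρ hb hx
  have e : ρ / 2 / ρ = 1 / 2 := by field_simp
  rw [e] at h
  exact tsum_of_norm_bounded (hasSum_geometric_two.mul_left D) h

/-- Coefficient bounds for the derivative of the series: the extra factor `n + 1 ≤ 2ⁿ` is paid for
by halving the radius. -/
theorem egf_bound_shift {b : ℕ → ℂ} {ρ D : ℝ} (hρ : 0 < ρ)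
    (hb : ∀ n, ‖b n‖ * ρ ^ n ≤ D * n.factorial) (n : ℕ) :
    ‖b (n + 1)‖ * (ρ / 2) ^ n ≤ D / ρ * n.factorial := by
  have hD := egf_bound_nonneg hb
  have h := hb (n + 1)
  have h2 : ((n + 1 : ℕ) : ℝ) ≤ 2 ^ n := by exact_mod_cast Nat.lt_two_pow_self
  rw [pow_succ, ← mul_assoc, ← le_div_iff₀ hρ] at h
  rw [div_pow, ← mul_div_assoc, div_le_iff₀ (by positivity)]
  refine h.trans ?_
  rw [Nat.factorial_succ, Nat.cast_mul]
  calc D * (((n + 1 : ℕ) : ℝ) * n.factorial) / ρ ≤ D * (2 ^ n * n.factorial) / ρ := by gcongr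
    _ = _ := by ring

theorem hasDerivAt_egf {b : ℕ → ℂ} {ρ D : ℝ} (hb : ∀ n, ‖b n‖ * ρ ^ n ≤ D * n.factorial) {x : ℝ}
    (hx : |x| < ρ) : HasDerivAt (egf b) (egf (fun n => b (n + 1)) x) x := by
  have hρ : 0 < ρ := (abs_nonneg x).trans_lt hx
  have hD := egf_bound_nonneg hb
  obtain ⟨r, hxr, hrρ⟩ := exists_between hx
  have hr : 0 < r := (abs_nonneg x).trans_lt hxr
  have hq : ‖r / ρ‖ < 1 := by
    rw [Real.norm_of_nonneg (by positivity)]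
    exact (div_lt_one hρ).2 hrρ
  have hsum : Summable fun n : ℕ => D / r * ((n : ℝ) ^ 1 * (r / ρ) ^ n) :=
    (summable_pow_mul_geometric_of_norm_lt_one 1 hq).mul_left _
  have hder : ∀ (n : ℕ) (y : ℝ), HasDerivAt (fun y : ℝ => b n * ((y : ℂ) ^ n / n.factorial))
      (b n * ((n * (y : ℂ) ^ (n - 1)) / n.factorial)) y := by
    intro n y
    have := ((hasDerivAt_pow n (y : ℂ)).comp_ofReal.div_const (n.factorial : ℂ)).const_mul (b n)
    simpa using this
  have hbound : ∀ (n : ℕ) (y : ℝ), y ∈ Ioo (-r) r →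
      ‖b n * ((n * (y : ℂ) ^ (n - 1)) / n.factorial)‖ ≤ D / r * ((n : ℝ) ^ 1 * (r / ρ) ^ n) := by
    intro n y hy
    rcases n with _ | n
    · simp
    have hyr : |y| ≤ r := (abs_lt.2 hy).le
    have h := norm_egf_term_le hρ hb (le_refl |r|) (n + 1)
    have hf : (0 : ℝ) < (n + 1).factorial := by positivity
    rw [abs_of_pos hr, norm_mul, norm_div, norm_pow, Complex.norm_real, Real.norm_of_nonneg hr.le,
      Complex.norm_natCast] at h
    rw [norm_mul, norm_div, norm_mul, norm_pow, Complex.norm_real, Real.norm_eq_abs,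
      Complex.norm_natCast, Complex.norm_natCast, Nat.add_sub_cancel, pow_one]
    calc ‖b (n + 1)‖ * (((n + 1 : ℕ) : ℝ) * |y| ^ n / (n + 1).factorial)
        ≤ ‖b (n + 1)‖ * (((n + 1 : ℕ) : ℝ) * r ^ n / (n + 1).factorial) := by gcongr
      _ = ((n + 1 : ℕ) : ℝ) / r * (‖b (n + 1)‖ * (r ^ (n + 1) / (n + 1).factorial)) := by
          rw [pow_succ]; field_simp
      _ ≤ ((n + 1 : ℕ) : ℝ) / r * (D * (r / ρ) ^ (n + 1)) := by gcongr
      _ = _ := by ring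
  have hs0 : Summable fun n => b n * (((0 : ℝ) : ℂ) ^ n / n.factorial) := by
    refine summable_of_ne_finset_zero (s := {0}) fun n hn => ?_
    simp [(by simpa using hn : n ≠ 0)]
  have h := hasDerivAt_tsum_of_isPreconnected hsum isOpen_Ioo isPreconnected_Ioo
    (fun n y _ => hder n y) hbound (y₀ := 0) (by simp [hr]) hs0 (abs_lt.1 hxr)
  refine h.congr_deriv ?_
  have hs1 : Summable fun n : ℕ => b n * ((n * (x : ℂ) ^ (n - 1)) / n.factorial) :=
    Summable.of_norm_bounded hsum fun n => hbound n x (abs_lt.1 hxr)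
  rw [hs1.tsum_eq_zero_add, egf]
  simp only [Nat.cast_zero, zero_mul, zero_div, mul_zero, zero_add]
  refine tsum_congr fun n => ?_
  have : ((n + 1 : ℕ) : ℂ) ≠ 0 := Nat.cast_ne_zero.2 n.succ_ne_zero
  rw [Nat.factorial_succ, Nat.cast_mul, Nat.add_sub_cancel, mul_div_mul_left _ _ this]

theorem continuousOn_egf {G : ℕ → ℝ → ℂ} {S : Set ℝ} {ρ D L : ℝ} (hL : 0 < L) (hLρ : L < ρ)
    (hG : ∀ n, ContinuousOn (G n) S) (hb : ∀ s ∈ S, ∀ n, ‖G n s‖ * ρ ^ n ≤ D * n.factorial) :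
    ContinuousOn (fun p : ℝ × ℝ => egf (fun n => G n p.1) p.2) (S ×ˢ Icc (-L) L) := by
  have hρ := hL.trans hLρ
  refine continuousOn_tsum (u := fun n => D * (L / ρ) ^ n) (fun n => ?_) ?_ ?_
  · refine ((hG n).comp continuousOn_fst fun p hp => hp.1).mul ?_
    exact (by fun_prop : Continuous fun p : ℝ × ℝ => (p.2 : ℂ) ^ n / (n.factorial : ℂ)).continuousOn
  · exact (summable_geometric_of_lt_one (by positivity) ((div_lt_one hρ).2 hLρ)).mul_left D
  · intro n p hp
    exact norm_egf_term_le hρ (hb p.1 hp.1) (abs_le.2 hp.2) n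

/-- A solution from its Taylor coefficients in `x`, whose even and odd parts are the successive
time derivatives of two flat outputs. -/
theorem bddReachable_of_flat_output {L T D : ℝ} (hL : 0 < L) (hT : 0 < T) {G : ℕ → ℝ → ℂ}
    (hG : ∀ n, ∀ s ∈ Icc 0 T, HasDerivAt (G n) (G (n + 2) s) s) (h0 : ∀ n, G n 0 = 0)
    (hb : ∀ s ∈ Icc 0 T, ∀ n, ‖G n s‖ * (16 * L) ^ n ≤ D * n.factorial) :
    BddReachable L T (egf fun n => G n T) := by
  have cG : ∀ n, ContinuousOn (G n) (Icc 0 T) := fun n s hs =>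
    (hG n s hs).continuousAt.continuousWithinAt
  have hb1 : ∀ s ∈ Icc 0 T, ∀ n, ‖G (n + 1) s‖ * (16 * L / 2) ^ n ≤ D / (16 * L) * n.factorial :=
    fun s hs n => egf_bound_shift (b := fun n => G n s) (by positivity) (hb s hs) n
  have hb2 : ∀ s ∈ Icc 0 T, ∀ n, ‖G (n + 1 + 1) s‖ * (16 * L / 2 / 2) ^ n ≤
      D / (16 * L) / (16 * L / 2) * n.factorial :=
    fun s hs n => egf_bound_shift (b := fun n => G (n + 1) s) (by positivity) (hb1 s hs) n
  -- Differentiating in `t`, or twice in `x`, shifts the coefficients by two, so the heat equation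
  -- holds termwise. The radius goes `16L`, `8L`, `4L` over the two shifts and stays beyond `L`.
  refine bddReachable_of_classical hL hT (u := fun s => egf fun n => G n s)
    (ut := fun s => egf fun n => G (n + 1 + 1) s) (ux := fun s => egf fun n => G (n + 1) s)
    (continuousOn_egf hL (by linarith) cG hb)
    (continuousOn_egf hL (by linarith) (fun n => cG (n + 1 + 1)) hb2) ?_ ?_ ?_ ?_
  · intro s hs x hx
    have hx' := abs_le.2 hx
    refine hasDerivAt_tsum_of_isPreconnected
      (u := fun n => D / (16 * L) / (16 * L / 2) * (L / (16 * L / 2 / 2)) ^ n) ?_ isOpen_Ioo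
      isPreconnected_Ioo
      (fun n r hr => (hG n r (Ioo_subset_Icc_self hr)).mul_const _)
      (fun n r hr => norm_egf_term_le (b := fun n => G (n + 1 + 1) r) (by positivity)
        (hb2 r (Ioo_subset_Icc_self hr)) hx' n) hs ?_ hs
    · have e : L / (16 * L / 2 / 2) = 1 / 4 := by field_simp; norm_num
      rw [e]
      exact (summable_geometric_of_lt_one (by norm_num) (by norm_num)).mul_left _
    · refine Summable.of_norm_bounded (g := fun n => D * (L / (16 * L)) ^ n) ?_
        fun n => norm_egf_term_le (b := fun n => G n s) (by positivity)
          (hb s (Ioo_subset_Icc_self hs)) hx' n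
      have e : L / (16 * L) = 1 / 16 := by field_simp
      rw [e]
      exact (summable_geometric_of_lt_one (by norm_num) (by norm_num)).mul_left _
  · intro s hs x hx
    have hx' := abs_le.2 hx
    exact hasDerivAt_egf (hb s (Ioo_subset_Icc_self hs)) (by linarith)
  · intro s hs x hx
    have hx' := abs_le.2 hx
    exact hasDerivAt_egf (b := fun n => G (n + 1) s) (hb1 s (Ioo_subset_Icc_self hs)) (by linarith)
  · intro x _
    simp [egf, h0]

/-- The even and odd traces at `x = 0` of the backward heat evolution of `egf a`. -/
theorem exists_analytic_traces {T C R : ℝ} (hR : 0 < R) {a : ℕ → ℂ}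
    (ha : ∀ n, ‖a n‖ ≤ C * R ^ (n / 2) * (n / 2).factorial) :
    ∃ (Y : ℕ → ℝ → ℂ) (ρ : ℝ), 0 < ρ ∧
      (∀ n s, |s - T| < ρ → HasDerivAt (Y n) (Y (n + 2) s) s) ∧
      (∀ n s, |s - T| ≤ ρ / 2 → ‖Y n s‖ ≤ (C * (2 * R) ^ (n / 2) * (n / 2).factorial) * 2) ∧
      ∀ n, Y n T = a n := by
  -- Time derivatives at `T` are the coefficients `a (n + 2k)`. As `(n/2 + k)! ≤ 2 ^ (n/2 + k)
  -- (n/2)! k!`, they grow like `(2R)ᵏ k!`, which gives this radius of analyticity.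
  set ρ : ℝ := 1 / (2 * R) with hρdef
  have hρ : 0 < ρ := by positivity
  have hC : 0 ≤ C := by simpa using (norm_nonneg _).trans (ha 0)
  set Y : ℕ → ℝ → ℂ := fun n s => egf (fun k => a (n + 2 * k)) (s - T) with hY
  have hYb : ∀ n k, ‖a (n + 2 * k)‖ * ρ ^ k ≤
      (C * (2 * R) ^ (n / 2) * (n / 2).factorial) * k.factorial := by
    intro n k
    have hdiv : (n + 2 * k) / 2 = n / 2 + k := by omega
    have h := ha (n + 2 * k)
    rw [hdiv] at h
    have hch : ((n / 2 + k).factorial : ℝ) ≤ 2 ^ (n / 2 + k) * ((n / 2).factorial * k.factorial) := by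
      have h1 := Nat.add_choose_mul_factorial_mul_factorial (n / 2) k
      have h2 := Nat.choose_le_two_pow (n / 2 + k) k
      rw [mul_assoc] at h1
      rw [← h1]
      exact_mod_cast Nat.mul_le_mul_right _ h2
    calc ‖a (n + 2 * k)‖ * ρ ^ k
        ≤ (C * R ^ (n / 2 + k) * (n / 2 + k).factorial) * ρ ^ k := by gcongr
      _ ≤ (C * R ^ (n / 2 + k) * (2 ^ (n / 2 + k) * ((n / 2).factorial * k.factorial))) * ρ ^ k := by
          gcongr
      _ = (C * (2 * R) ^ (n / 2) * (n / 2).factorial) * k.factorial * ((2 * R) * ρ) ^ k := by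
          rw [pow_add, pow_add, mul_pow, mul_pow, mul_pow]; ring
      _ = _ := by
          rw [hρdef, mul_one_div_cancel (by positivity), one_pow, mul_one]
  have dY : ∀ n s, |s - T| < ρ → HasDerivAt (Y n) (Y (n + 2) s) s := by
    intro n s hs
    have h := (hasDerivAt_egf (hYb n) hs).comp_sub_const s T
    refine h.congr_deriv ?_
    simp only [hY]
    congr 1
    funext k
    congr 1
    ring
  have nY : ∀ n s, |s - T| ≤ ρ / 2 → ‖Y n s‖ ≤ (C * (2 * R) ^ (n / 2) * (n / 2).factorial) * 2 :=
    fun n s hs => norm_egf_le hρ (hYb n) hs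
  have Y0 : ∀ n, Y n T = a n := by
    intro n
    simp only [hY, egf, sub_self]
    rw [tsum_eq_single 0 fun k hk => by simp [hk]]
    simp
  exact ⟨Y, ρ, hρ, dY, nY, Y0⟩

/-- Null controllability: entire states whose Taylor coefficients grow like those of a Gaussian are
reachable in every time. -/
theorem bddReachable_egf {L T C R : ℝ} (hL : 0 < L) (hT : 0 < T) (hR : 0 < R) {a : ℕ → ℂ}
    (ha : ∀ n, ‖a n‖ ≤ C * R ^ (n / 2) * (n / 2).factorial) : BddReachable L T (egf a) := by
  have hC : 0 ≤ C := by simpa using (norm_nonneg _).trans (ha 0)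
  obtain ⟨Y, ρ, hρ, dY, nY, Y0⟩ := exists_analytic_traces (T := T) hR ha
  -- The product of step and traces has rate `2ε`, and `2ε (16L)² = 1` is what convergence at radius
  -- `16L` requires.
  set ε : ℝ := 1 / (2 * (16 * L) ^ 2) with hεdef
  have hε : 0 < ε := by positivity
  -- The step rises only during the last `T₁` units of time, where the traces `Y` are analytic;
  -- before that the product is zero.
  set T₁ : ℝ := min T (ρ / 2) with hT₁
  have hT₁0 : 0 < T₁ := lt_min hT (by positivity)
  have hT₁T : T₁ ≤ T := min_le_left _ _
  have hT₁ρ : T₁ ≤ ρ / 2 := min_le_right _ _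
  obtain ⟨X, B, dX, X0, XT, XT', nX⟩ := exists_gevrey_step hε hT₁0
  have hB : 0 ≤ B := by
    simpa using (norm_nonneg _).trans (nX 0 0 (left_mem_Icc.2 hT₁0.le))
  set X' : ℕ → ℝ → ℂ := fun n s => X n (s - (T - T₁)) with hX'
  have dX' : ∀ n s, HasDerivAt (X' n) (X' (n + 1) s) s := fun n s =>
    (dX n (s - (T - T₁))).comp_sub_const s (T - T₁)
  set F : ℕ → ℕ → ℝ → ℂ := fun b => jetMul X' fun k => Y (b + 2 * k) with hF
  have F0 : ∀ b i, ∀ s ≤ T - T₁, F b i s = 0 := by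
    intro b i s hs
    simp [hF, jetMul, hX', X0 _ (s - (T - T₁)) (by linarith)]
  have dF : ∀ b i, ∀ s ∈ Icc 0 T, HasDerivAt (F b i) (F b (i + 1) s) s := by
    intro b i s hs
    rcases lt_or_ge s (T - T₁) with h | h
    · rw [F0 b _ s h.le]
      refine (hasDerivAt_const s (0 : ℂ)).congr_of_eventuallyEq ?_
      filter_upwards [gt_mem_nhds h] with r hr using F0 b i r hr.le
    · have hs' : |s - T| < ρ := by
        rw [abs_sub_comm, abs_of_nonneg (by linarith [hs.2])]
        linarith
      exact hasDerivAt_jetMul (fun n => dX' n s) (fun n => dY (b + 2 * n) s hs') i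
  -- An analytic function is Gevrey of order two with any rate: `(2R)ⁿ ≤ A εⁿ n!`, by one term of
  -- the exponential series.
  set A : ℝ := Real.exp (2 * R / ε) with hA
  have nF : ∀ b < 2, ∀ i, ∀ s ∈ Icc 0 T,
      ‖F b i s‖ ≤ B * (2 * C * A) * (2 * ε) ^ i * (2 * i).factorial := by
    intro b hb2 i s hs
    rcases lt_or_ge s (T - T₁) with h | h
    · rw [F0 b i s h.le, norm_zero]
      positivity
    · have hs' : |s - T| ≤ ρ / 2 := by
        rw [abs_sub_comm, abs_of_nonneg (by linarith [hs.2])]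
        linarith
      have hsI : s - (T - T₁) ∈ Icc 0 T₁ := ⟨by linarith, by linarith [hs.2]⟩
      refine norm_jetMul_le (X := X') (Y := fun k => Y (b + 2 * k)) (s := s) (C := B)
        (D := 2 * C * A) hε.le (fun n => nX n (s - (T - T₁)) hsI) (fun n => ?_) i
      have hdiv : (b + 2 * n) / 2 = n := by omega
      have h1 := nY (b + 2 * n) s hs'
      rw [hdiv] at h1
      refine h1.trans ?_
      have h2 := Real.pow_div_factorial_le_exp (2 * R / ε) (by positivity) n
      rw [div_le_iff₀ (by positivity), div_pow, div_le_iff₀ (by positivity)] at h2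
      have hf : (n.factorial * n.factorial : ℝ) ≤ (2 * n).factorial := by
        have := Nat.le_of_dvd (Nat.factorial_pos _)
          (Nat.factorial_mul_factorial_dvd_factorial_add n n)
        rw [← two_mul] at this
        exact_mod_cast this
      calc C * (2 * R) ^ n * n.factorial * 2
          ≤ C * (A * n.factorial * ε ^ n) * n.factorial * 2 := by gcongr
        _ = 2 * C * A * ε ^ n * (n.factorial * n.factorial) := by ring
        _ ≤ _ := by gcongr
  have hfin : (egf fun n => F (n % 2) (n / 2) T) = egf a := by
    congr 1
    funext n
    simp only [hF, jetMul]
    -- At time `T` the step has jet `(1, 0, 0, …)`, so only the undifferentiated step contributes.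
    rw [Finset.sum_eq_single (0, n / 2)]
    · have e : n % 2 + 2 * (n / 2) = n := by omega
      simp [hX', XT, e, Y0]
    · rintro ⟨j, k⟩ hjk hne
      have hj : j ≠ 0 := by
        rintro rfl
        apply hne
        have := Finset.HasAntidiagonal.mem_antidiagonal.1 hjk
        simp only [zero_add] at this
        rw [this]
      obtain ⟨m, rfl⟩ := Nat.exists_eq_succ_of_ne_zero hj
      simp [hX', XT']
    · simp
  rw [← hfin]
  refine bddReachable_of_flat_output (D := B * (2 * C * A) * (1 + 16 * L)) hL hT
    (G := fun n => F (n % 2) (n / 2)) ?_ ?_ ?_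
  · intro n s hs
    have e1 : (n + 2) % 2 = n % 2 := by omega
    have e2 : (n + 2) / 2 = n / 2 + 1 := by omega
    rw [e1, e2]
    exact dF _ _ s hs
  · exact fun n => F0 _ _ 0 (by linarith)
  · intro s hs n
    have h := nF (n % 2) (Nat.mod_lt _ two_pos) (n / 2) s hs
    have hn : 2 * (n / 2) + n % 2 = n := Nat.div_add_mod n 2
    have hfac : ((2 * (n / 2)).factorial : ℝ) ≤ n.factorial := by
      exact_mod_cast Nat.factorial_le (by omega)
    -- For odd `n` one factor `16L` is left over; the constant `D` accounts for it.
    have hpow : (16 * L) ^ (n % 2) ≤ 1 + 16 * L := by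
      rcases Nat.mod_two_eq_zero_or_one n with h | h <;> rw [h] <;> simp
      positivity
    have e : (2 * ε) ^ (n / 2) * (16 * L) ^ n = (16 * L) ^ (n % 2) := by
      nth_rewrite 2 [← hn]
      rw [pow_add, pow_mul, ← mul_assoc, ← mul_pow, hεdef]
      have : 2 * (1 / (2 * (16 * L) ^ 2)) * (16 * L) ^ 2 = 1 := by field_simp
      rw [this, one_pow, one_mul]
    calc ‖F (n % 2) (n / 2) s‖ * (16 * L) ^ n
        ≤ (B * (2 * C * A) * (2 * ε) ^ (n / 2) * (2 * (n / 2)).factorial) * (16 * L) ^ n := by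
          gcongr
      _ = B * (2 * C * A) * ((2 * ε) ^ (n / 2) * (16 * L) ^ n) * (2 * (n / 2)).factorial := by ring
      _ = B * (2 * C * A) * (16 * L) ^ (n % 2) * (2 * (n / 2)).factorial := by rw [e]
      _ ≤ _ := by gcongr

/-- Null controllability: the restriction to the line of an entire function of Gaussian growth is
reachable in every time. -/
theorem bddReachable_of_entire {L T C B : ℝ} (hL : 0 < L) (hT : 0 < T) {r : ℂ → ℂ}
    (hr : Differentiable ℂ r) (hrB : ∀ ζ, ‖r ζ‖ ≤ C * Real.exp (B * ‖ζ‖ ^ 2)) :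
    BddReachable L T (fun x => r x) := by
  have hC : 0 ≤ C := by
    have := (norm_nonneg _).trans (hrB 0)
    simpa using this
  have hegf : egf (fun n => iteratedDeriv n r 0) = fun x : ℝ => r x := by
    funext x
    have h := (Complex.hasSum_taylorSeries_of_entire hr 0 x).tsum_eq
    rw [← h, egf]
    refine tsum_congr fun n => ?_
    simp only [sub_zero, smul_eq_mul]
    ring
  rw [← hegf]
  refine bddReachable_egf (C := C * Real.exp B) (R := 16 * Real.exp B) hL hT (by positivity) ?_
  intro n
  set i := n / 2 with hi
  -- Cauchy's estimate at radius `√(i + 1)`: the Gaussian growth costs only `exp (B (i + 1))`, while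
  -- `ρⁿ ≥ i!` cancels one of the two factorials in `n! ≤ 16ⁱ i!²`.
  have hρ : 0 < Real.sqrt (i + 1) := by positivity
  have hsq : Real.sqrt (i + 1) ^ 2 = i + 1 := Real.sq_sqrt (by positivity)
  have hρ1 : 1 ≤ Real.sqrt (i + 1) := by
    rw [Real.one_le_sqrt]
    have : (0 : ℝ) ≤ i := by positivity
    linarith
  have h := Complex.norm_iteratedDeriv_le_of_forall_mem_sphere_norm_le n hρ
    (f := r) (c := 0) (C := C * Real.exp (B * (i + 1))) hr.diffContOnCl ?_
  swap
  · intro z hz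
    have hz' : ‖z‖ = Real.sqrt (i + 1) := by simpa using hz
    simpa [hz', hsq] using hrB z
  refine h.trans ?_
  have hfac : (n.factorial : ℝ) ≤ 16 ^ i * (i.factorial * i.factorial) := by
    have h1 : n.factorial ≤ (2 * i + 1).factorial := Nat.factorial_le (by omega)
    have h2 : (2 * i + 1).factorial = (2 * i + 1) * ((i + i).choose i * i.factorial * i.factorial) := by
      rw [Nat.factorial_succ, Nat.add_choose_mul_factorial_mul_factorial, two_mul]
    have h3 : (i + i).choose i ≤ 2 ^ (i + i) := Nat.choose_le_two_pow _ _
    have h4 : 2 * i + 1 ≤ 2 ^ (2 * i) := Nat.lt_two_pow_self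
    have h5 : n.factorial ≤ 16 ^ i * (i.factorial * i.factorial) := by
      calc n.factorial ≤ (2 * i + 1) * ((i + i).choose i * i.factorial * i.factorial) := h2 ▸ h1
        _ ≤ 2 ^ (2 * i) * (2 ^ (i + i) * i.factorial * i.factorial) := by gcongr
        _ = (2 ^ 4) ^ i * (i.factorial * i.factorial) := by
            rw [← pow_mul]; ring
        _ = _ := by norm_num
    exact_mod_cast h5
  have hpow : (i.factorial : ℝ) ≤ Real.sqrt (i + 1) ^ n := by
    calc (i.factorial : ℝ) ≤ (i + 1) ^ i := by
          exact_mod_cast (Nat.factorial_le_pow i).trans (Nat.pow_le_pow_left (Nat.le_succ i) i)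
      _ = Real.sqrt (i + 1) ^ (2 * i) := by rw [pow_mul, hsq]
      _ ≤ _ := pow_le_pow_right₀ hρ1 (by omega)
  rw [div_le_iff₀ (by positivity)]
  have hexp : Real.exp (B * (i + 1)) = Real.exp B * Real.exp B ^ i := by
    rw [← Real.exp_nat_mul, ← Real.exp_add]
    congr 1
    ring
  calc n.factorial * (C * Real.exp (B * (i + 1)))
      ≤ (16 ^ i * (i.factorial * i.factorial)) * (C * Real.exp (B * (i + 1))) := by gcongr
    _ = C * Real.exp B * (16 * Real.exp B) ^ i * i.factorial * i.factorial := by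
        rw [hexp, mul_pow]; ring
    _ ≤ _ := by gcongr

/-! ### Gaussian profiles and causal heat kernels -/

/-- The profile `t ^ (-b) * exp (-x² / 4t)`, extended by zero to `t ≤ 0`. -/
def gaussProfile (b t x : ℝ) : ℝ :=
  if 0 < t then t ^ (-b) * Real.exp (-(x ^ 2 / 4 / t)) else 0

theorem gaussProfile_of_nonpos (b x : ℝ) {t : ℝ} (ht : t ≤ 0) : gaussProfile b t x = 0 :=
  if_neg ht.not_gt

theorem gaussProfile_of_pos (b x : ℝ) {t : ℝ} (ht : 0 < t) :
    gaussProfile b t x = t ^ (-b) * Real.exp (-(x ^ 2 / 4 / t)) := if_pos ht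

theorem gaussProfile_nonneg (b t x : ℝ) : 0 ≤ gaussProfile b t x := by
  unfold gaussProfile
  split_ifs with h <;> positivity

theorem measurable_gaussProfile (b : ℝ) :
    Measurable fun p : ℝ × ℝ => gaussProfile b p.1 p.2 :=
  Measurable.ite (measurableSet_lt measurable_const measurable_fst) (by fun_prop) measurable_const

/-- Away from `x = 0` the Gaussian beats every power of `1 / t`. Order two in `t` serves both
continuity and differentiability across `t = 0`. The two constants cover `t ≥ 1`, where `t ^ (-b) ≤
1`, and `t < 1`, where `t ^ (-b) ≤ t ^ (-N)`. -/
theorem exists_gaussProfile_le {b δ : ℝ} (hb : 0 ≤ b) (hδ : 0 < δ) :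
    ∃ C, ∀ t x, δ ≤ |x| → gaussProfile b t x ≤ C * t ^ 2 := by
  obtain ⟨N, hN⟩ := exists_nat_ge b
  have ha : 0 < δ ^ 2 / 4 := by positivity
  refine ⟨(0 + 2).factorial / (δ ^ 2 / 4) ^ (0 + 2) + (N + 2).factorial / (δ ^ 2 / 4) ^ (N + 2),
    fun t x hx => ?_⟩
  rcases lt_or_ge 0 t with ht | ht
  · have h0 := pow_mul_exp_neg_le ha 0 2 ht
    have hN' := pow_mul_exp_neg_le ha N 2 ht
    have hexp : Real.exp (-(x ^ 2 / 4 / t)) ≤ Real.exp (-(δ ^ 2 / 4 / t)) := by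
      have : δ ^ 2 ≤ x ^ 2 := by
        rw [← sq_abs x]
        gcongr
      gcongr
    have hpow : t ^ (-b) ≤ 1 / t ^ 0 + 1 / t ^ N := by
      rcases le_or_gt 1 t with h1 | h1
      · have : t ^ (-b) ≤ 1 := Real.rpow_le_one_of_one_le_of_nonpos h1 (by linarith)
        have h2 : 0 ≤ 1 / t ^ N := by positivity
        simp only [pow_zero, div_one]
        linarith
      · have : t ^ (-b) ≤ t ^ (-(N : ℝ)) :=
          Real.rpow_le_rpow_of_exponent_ge ht h1.le (by linarith)
        rw [Real.rpow_neg ht.le (N : ℝ), Real.rpow_natCast, ← one_div] at this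
        simp only [pow_zero, div_one]
        linarith
    rw [gaussProfile_of_pos b x ht]
    calc t ^ (-b) * Real.exp (-(x ^ 2 / 4 / t))
        ≤ (1 / t ^ 0 + 1 / t ^ N) * Real.exp (-(δ ^ 2 / 4 / t)) := by gcongr
      _ = Real.exp (-(δ ^ 2 / 4 / t)) / t ^ 0 + Real.exp (-(δ ^ 2 / 4 / t)) / t ^ N := by ring
      _ ≤ _ := by linarith
  · rw [gaussProfile_of_nonpos b x ht]
    positivity

theorem continuousOn_gaussProfile {b : ℝ} (hb : 0 ≤ b) :
    ContinuousOn (fun p : ℝ × ℝ => gaussProfile b p.1 p.2) {p | p.2 ≠ 0} := by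
  rintro ⟨t, x⟩ (hx : x ≠ 0)
  refine ContinuousAt.continuousWithinAt ?_
  rcases lt_trichotomy 0 t with ht | rfl | ht
  · have hc : ContinuousAt
        (fun p : ℝ × ℝ => p.1 ^ (-b) * Real.exp (-(p.2 ^ 2 / 4 / p.1))) (t, x) := by
      refine ContinuousAt.mul (ContinuousAt.rpow_const continuousAt_fst (Or.inl ht.ne')) ?_
      refine Real.continuous_exp.continuousAt.comp (ContinuousAt.neg ?_)
      exact ContinuousAt.div (by fun_prop) continuousAt_fst ht.ne'
    refine hc.congr ?_
    filter_upwards [(isOpen_lt continuous_const continuous_fst).mem_nhds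
      (show (t, x) ∈ {p : ℝ × ℝ | 0 < p.1} from ht)] with p hp
    exact (gaussProfile_of_pos b p.2 hp).symm
  · obtain ⟨C, hC⟩ := exists_gaussProfile_le hb (half_pos (abs_pos.2 hx))
    have hlim : Filter.Tendsto (fun p : ℝ × ℝ => C * p.1 ^ 2) (nhds ((0 : ℝ), x)) (nhds 0) := by
      have : Continuous fun p : ℝ × ℝ => C * p.1 ^ 2 := by fun_prop
      simpa using this.tendsto ((0 : ℝ), x)
    rw [ContinuousAt, gaussProfile_of_nonpos b x le_rfl]
    refine squeeze_zero' (Filter.Eventually.of_forall fun p => gaussProfile_nonneg _ _ _) ?_ hlim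
    have hopen : IsOpen {p : ℝ × ℝ | |x| / 2 < |p.2|} :=
      isOpen_lt continuous_const (by fun_prop)
    filter_upwards [hopen.mem_nhds (show ((0 : ℝ), x) ∈ {p : ℝ × ℝ | |x| / 2 < |p.2|} from
      half_lt_self (abs_pos.2 hx))] with p hp
    exact hC p.1 p.2 (le_of_lt hp)
  · refine (continuousAt_const (y := (0 : ℝ))).congr ?_
    filter_upwards [(isOpen_lt continuous_fst continuous_const).mem_nhds
      (show (t, x) ∈ {p : ℝ × ℝ | p.1 < 0} from ht)] with p hp
    exact (gaussProfile_of_nonpos b p.2 (le_of_lt hp)).symm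

theorem hasDerivAt_gaussProfile_space (b t x : ℝ) :
    HasDerivAt (gaussProfile b t) (-(x / 2) * gaussProfile (b + 1) t x) x := by
  rcases lt_or_ge 0 t with ht | ht
  · have h : HasDerivAt (fun x => t ^ (-b) * Real.exp (-(x ^ 2 / 4 / t)))
        (t ^ (-b) * (Real.exp (-(x ^ 2 / 4 / t)) * -(2 * x / 4 / t))) x := by
      have h1 : HasDerivAt (fun x : ℝ => -(x ^ 2 / 4 / t)) (-(2 * x / 4 / t)) x := by
        refine (((hasDerivAt_pow 2 x).div_const 4).div_const t).neg.congr_deriv ?_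
        simp
      exact h1.exp.const_mul _
    have e : gaussProfile b t = fun x => t ^ (-b) * Real.exp (-(x ^ 2 / 4 / t)) :=
      funext fun x => gaussProfile_of_pos b x ht
    rw [e]
    refine h.congr_deriv ?_
    rw [gaussProfile_of_pos _ x ht, neg_add, ← sub_eq_add_neg, Real.rpow_sub_one ht.ne']
    field_simp
    ring
  · have e : gaussProfile b t = fun _ => 0 := funext fun x => gaussProfile_of_nonpos b x ht
    rw [e, gaussProfile_of_nonpos _ x ht, mul_zero]
    exact hasDerivAt_const x 0

theorem hasDerivAt_gaussProfile_time {b : ℝ} (hb : 0 ≤ b) (t : ℝ) {x : ℝ} (hx : x ≠ 0) :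
    HasDerivAt (fun t => gaussProfile b t x)
      (-b * gaussProfile (b + 1) t x + x ^ 2 / 4 * gaussProfile (b + 2) t x) t := by
  rcases lt_trichotomy 0 t with ht | rfl | ht
  · have h : HasDerivAt (fun t => t ^ (-b) * Real.exp (-(x ^ 2 / 4 / t)))
        ((-b * t ^ (-b - 1)) * Real.exp (-(x ^ 2 / 4 / t)) +
          t ^ (-b) * (Real.exp (-(x ^ 2 / 4 / t)) * (x ^ 2 / 4 / t ^ 2))) t := by
      have h1 : HasDerivAt (fun t : ℝ => -(x ^ 2 / 4 / t)) (x ^ 2 / 4 / t ^ 2) t := by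
        have := ((hasDerivAt_inv ht.ne').const_mul (x ^ 2 / 4)).neg
        refine this.congr_deriv ?_
        field_simp
      exact (Real.hasDerivAt_rpow_const (Or.inl ht.ne')).mul h1.exp
    have h' := h.congr_of_eventuallyEq (f₁ := fun t => gaussProfile b t x) (by
      filter_upwards [lt_mem_nhds ht] with r hr using gaussProfile_of_pos b x hr)
    refine h'.congr_deriv ?_
    have e2 : t ^ (-(b + 2)) = t ^ (-b) / t ^ 2 := by
      rw [neg_add, ← sub_eq_add_neg, Real.rpow_sub ht, Real.rpow_two]
    have e1 : t ^ (-(b + 1)) = t ^ (-b - 1) := by ring_nf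
    rw [gaussProfile_of_pos _ x ht, gaussProfile_of_pos _ x ht, e1, e2]
    ring
  · obtain ⟨C, hC⟩ := exists_gaussProfile_le hb (abs_pos.2 hx)
    rw [gaussProfile_of_nonpos _ x le_rfl, gaussProfile_of_nonpos _ x le_rfl, mul_zero, mul_zero,
      add_zero]
    have hO : (fun t => gaussProfile b t x) =O[nhds 0] fun t : ℝ => ‖t - 0‖ ^ 2 := by
      refine Asymptotics.IsBigO.of_bound C (Filter.Eventually.of_forall fun t => ?_)
      rw [Real.norm_of_nonneg (gaussProfile_nonneg _ _ _)]
      simpa using hC t x le_rfl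
    simpa using (hO.hasFDerivAt one_lt_two).hasDerivAt
  · rw [gaussProfile_of_nonpos _ x ht.le, gaussProfile_of_nonpos _ x ht.le, mul_zero, mul_zero,
      add_zero]
    refine (hasDerivAt_const t (0 : ℝ)).congr_of_eventuallyEq ?_
    filter_upwards [gt_mem_nhds ht] with r hr using gaussProfile_of_nonpos b x hr.le

/-- A solution of the heat equation off `x = 0` that vanishes for `t ≤ 0`. -/
structure CausalKernel (κ κt κx : ℝ → ℝ → ℝ) : Prop where
  cont : ContinuousOn (fun p : ℝ × ℝ => κ p.1 p.2) {p | p.2 ≠ 0}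
  cont_t : ContinuousOn (fun p : ℝ × ℝ => κt p.1 p.2) {p | p.2 ≠ 0}
  deriv_t : ∀ t x, x ≠ 0 → HasDerivAt (fun t => κ t x) (κt t x) t
  deriv_x : ∀ t x, HasDerivAt (κ t) (κx t x) x
  deriv_xx : ∀ t x, HasDerivAt (κx t) (κt t x) x
  causal : ∀ t x, t ≤ 0 → κ t x = 0

/-- The heat kernel up to a constant. The factor `x ^ 0` gives it the form `x ^ e * gaussProfile b t
x` shared with the dipole. -/
theorem causalKernel_monopole : CausalKernel
    (fun t x => x ^ 0 * gaussProfile (1 / 2) t x)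
    (fun t x => -(1 / 2) * gaussProfile (3 / 2) t x + x ^ 2 / 4 * gaussProfile (5 / 2) t x)
    (fun t x => -(x / 2) * gaussProfile (3 / 2) t x) where
  cont := by simpa using continuousOn_gaussProfile (b := 1 / 2) (by norm_num)
  cont_t := by
    refine (continuousOn_const.mul (continuousOn_gaussProfile (b := 3 / 2) (by norm_num))).add
      (ContinuousOn.mul ?_ (continuousOn_gaussProfile (b := 5 / 2) (by norm_num)))
    fun_prop
  deriv_t := by
    intro t x hx
    have := hasDerivAt_gaussProfile_time (b := 1 / 2) (by norm_num) t hx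
    norm_num at this ⊢
    exact this
  deriv_x := by
    intro t x
    have := hasDerivAt_gaussProfile_space (1 / 2) t x
    norm_num at this ⊢
    exact this
  deriv_xx := by
    intro t x
    have h1 : HasDerivAt (fun x : ℝ => -(x / 2)) (-(1 / 2)) x := ((hasDerivAt_id x).div_const 2).neg
    have h := h1.mul (hasDerivAt_gaussProfile_space (3 / 2) t x)
    refine h.congr_deriv ?_
    norm_num
    ring
  causal := fun t x ht => by simp [gaussProfile_of_nonpos _ x ht]

/-- This is `-2` times the space derivative of the monopole. -/
theorem causalKernel_dipole : CausalKernel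
    (fun t x => x ^ 1 * gaussProfile (3 / 2) t x)
    (fun t x => x * (-(3 / 2) * gaussProfile (5 / 2) t x + x ^ 2 / 4 * gaussProfile (7 / 2) t x))
    (fun t x => gaussProfile (3 / 2) t x - x ^ 2 / 2 * gaussProfile (5 / 2) t x) where
  cont := by
    refine ContinuousOn.mul ?_ (continuousOn_gaussProfile (b := 3 / 2) (by norm_num))
    fun_prop
  cont_t := by
    refine continuousOn_snd.mul
      ((continuousOn_const.mul (continuousOn_gaussProfile (b := 5 / 2) (by norm_num))).add
      (ContinuousOn.mul ?_ (continuousOn_gaussProfile (b := 7 / 2) (by norm_num))))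
    fun_prop
  deriv_t := by
    intro t x hx
    have := (hasDerivAt_gaussProfile_time (b := 3 / 2) (by norm_num) t hx).const_mul (x ^ 1)
    refine this.congr_deriv ?_
    norm_num
  deriv_x := by
    intro t x
    have := (hasDerivAt_pow 1 x).mul (hasDerivAt_gaussProfile_space (3 / 2) t x)
    refine this.congr_deriv ?_
    norm_num
    ring
  deriv_xx := by
    intro t x
    have h1 := (hasDerivAt_pow 2 x).div_const 2
    have h := (hasDerivAt_gaussProfile_space (3 / 2) t x).sub
      (h1.mul (hasDerivAt_gaussProfile_space (5 / 2) t x))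
    refine h.congr_deriv ?_
    norm_num
    ring
  causal := fun t x ht => by simp [gaussProfile_of_nonpos _ x ht]

/-- A translated causal kernel with pole outside `[-L, L]` is a solution. -/
theorem CausalKernel.weakIdentity {κ κt κx : ℝ → ℝ → ℝ} (hκ : CausalKernel κ κt κx) {L T d z : ℝ}
    (hL : 0 < L) (hd : 0 ≤ d) (hz : ∀ x ∈ Icc (-L) L, x - z ≠ 0) (q : ℂ) {τ : ℝ}
    (hτ : τ ∈ Icc 0 T) {φ : ℝ → ℝ → ℂ} (hφ : ContDiff ℝ ∞ (Function.uncurry φ))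
    (hb : ∀ t ∈ Icc (0 : ℝ) τ, φ t (-L) = 0 ∧ φ t L = 0) :
    WeakIdentity L τ (fun s x => q * (κ (s - d) (x - z) : ℝ)) φ := by
  have hmaps : MapsTo (fun p : ℝ × ℝ => (p.1 - d, p.2 - z)) (Icc 0 T ×ˢ Icc (-L) L)
      {p | p.2 ≠ 0} := fun p hp => hz p.2 hp.2
  have hc : Continuous fun p : ℝ × ℝ => (p.1 - d, p.2 - z) := by fun_prop
  refine weakIdentity_of_classical hL (ut := fun s x => q * (κt (s - d) (x - z) : ℝ))
    (ux := fun s x => q * (κx (s - d) (x - z) : ℝ)) ?_ ?_ ?_ ?_ ?_ ?_ hτ hφ hb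
  · exact continuousOn_const.mul
      (Complex.continuous_ofReal.comp_continuousOn (hκ.cont.comp hc.continuousOn hmaps))
  · exact continuousOn_const.mul
      (Complex.continuous_ofReal.comp_continuousOn (hκ.cont_t.comp hc.continuousOn hmaps))
  · intro s _ x hx
    exact ((hκ.deriv_t (s - d) (x - z) (hz x hx)).comp_sub_const s d).ofReal_comp.const_mul q
  · intro s _ x _
    exact ((hκ.deriv_x (s - d) (x - z)).comp_sub_const x z).ofReal_comp.const_mul q
  · intro s _ x _
    exact ((hκ.deriv_xx (s - d) (x - z)).comp_sub_const x z).ofReal_comp.const_mul q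
  · intro x _
    rw [hκ.causal (0 - d) (x - z) (by linarith), Complex.ofReal_zero, mul_zero]

/-! ### The integral of `t⁻² exp (-A / 4t)` -/

/-- The antiderivative of `t⁻² exp (-A / 4t)` that vanishes at zero. -/
theorem exp_primitive {A : ℂ} (hA : 0 < A.re) :
    ∃ F : ℝ → ℂ, F 0 = 0 ∧ (∀ t, 0 < t → F t = 4 / A * Complex.exp (-A / (4 * t))) ∧
      Continuous F ∧
      ∀ t, 0 < t → HasDerivAt F (((t ^ 2 : ℝ) : ℂ)⁻¹ * Complex.exp (-A / (4 * t))) t := by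
  have hA0 : A ≠ 0 := fun h => by simp [h] at hA
  set F : ℝ → ℂ := fun t => if 0 < t then 4 / A * Complex.exp (-A / (4 * t)) else 0 with hF
  have hpos : ∀ t, 0 < t → F t = 4 / A * Complex.exp (-A / (4 * t)) := fun t ht => if_pos ht
  have hder : ∀ t, 0 < t →
      HasDerivAt F (((t ^ 2 : ℝ) : ℂ)⁻¹ * Complex.exp (-A / (4 * t))) t := by
    intro t ht
    have ht' : (t : ℂ) ≠ 0 := by exact_mod_cast ht.ne'
    have h1 : HasDerivAt (fun w : ℂ => -A / (4 * w)) (A / (4 * (t : ℂ) ^ 2)) (t : ℂ) := by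
      have := ((hasDerivAt_inv ht').const_mul (-A / 4))
      refine (this.congr_of_eventuallyEq ?_).congr_deriv ?_
      · filter_upwards with w
        rw [div_mul_eq_div_div, div_eq_mul_inv (-A / 4)]
      · field_simp
    have h2 := (h1.cexp.const_mul (4 / A)).comp_ofReal
    refine (h2.congr_of_eventuallyEq ?_).congr_deriv ?_
    · filter_upwards [lt_mem_nhds ht] with r hr using hpos r hr
    · push_cast
      field_simp
  refine ⟨F, if_neg (lt_irrefl _), hpos, ?_, hder⟩
  refine continuous_iff_continuousAt.2 fun t => ?_
  rcases lt_trichotomy 0 t with ht | rfl | ht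
  · exact (hder t ht).continuousAt
  · have hlim : Filter.Tendsto (fun t : ℝ => ‖4 / A‖ *
        ((0 + 1).factorial / (A.re / 4) ^ (0 + 1) * |t| ^ 1)) (nhds 0) (nhds 0) := by
      have : Continuous fun t : ℝ => ‖4 / A‖ *
        ((0 + 1).factorial / (A.re / 4) ^ (0 + 1) * |t| ^ 1) := by fun_prop
      simpa using this.tendsto 0
    rw [ContinuousAt, show F 0 = 0 from if_neg (lt_irrefl _)]
    refine squeeze_zero_norm (fun t => ?_) hlim
    rcases lt_or_ge 0 t with ht | ht
    · rw [hpos t ht, norm_mul, Complex.norm_exp]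
      have e : (-A / (4 * (t : ℂ))).re = -(A.re / 4 / t) := by
        rw [show (4 * (t : ℂ)) = ((4 * t : ℝ) : ℂ) by push_cast; ring, Complex.div_ofReal_re,
          Complex.neg_re]
        field_simp
      have := pow_mul_exp_neg_le (a := A.re / 4) (by positivity) 0 1 ht
      rw [e, abs_of_pos ht]
      gcongr
      simpa using this
    · rw [show F t = 0 from if_neg ht.not_gt, norm_zero]
      positivity
  · refine (continuousAt_const (y := (0 : ℂ))).congr ?_
    filter_upwards [gt_mem_nhds ht] with r hr
    exact (if_neg (not_lt.2 (le_of_lt hr))).symm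

theorem re_neg_div_four_mul (A : ℂ) (t : ℝ) : (-A / (4 * t)).re = -A.re / (4 * t) := by
  rw [show (4 * (t : ℂ)) = ((4 * t : ℝ) : ℂ) by push_cast; ring, Complex.div_ofReal_re,
    Complex.neg_re]

theorem norm_inv_sq_mul_exp (A : ℂ) {t : ℝ} :
    ‖((t ^ 2 : ℝ) : ℂ)⁻¹ * Complex.exp (-A / (4 * t))‖ =
      (t ^ 2)⁻¹ * Real.exp (-A.re / (4 * t)) := by
  rw [norm_mul, Complex.norm_exp, norm_inv, Complex.norm_real, Real.norm_of_nonneg (sq_nonneg t),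
    re_neg_div_four_mul]

theorem tendsto_exp_primitive (A : ℂ) : Filter.Tendsto
    (fun t : ℝ => 4 / A * Complex.exp (-A / (4 * t))) Filter.atTop (nhds (4 / A)) := by
  have h1 : Filter.Tendsto (fun t : ℝ => -A / 4 * ((t⁻¹ : ℝ) : ℂ)) Filter.atTop (nhds 0) := by
    have := (Complex.continuous_ofReal.tendsto 0).comp tendsto_inv_atTop_zero
    simpa using this.const_mul (-A / 4)
  have h2 := ((Complex.continuous_exp.tendsto 0).comp h1).const_mul (4 / A)
  rw [Complex.exp_zero, mul_one] at h2
  refine h2.congr fun t => ?_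
  simp only [Function.comp]
  rw [Complex.ofReal_inv, ← div_eq_mul_inv, div_div]

/-- The modulus of the integrand is the same integrand with `A` replaced by `A.re`: the nonnegative
derivative of a function with a finite limit at infinity. -/
theorem integrableOn_exp_primitive {A : ℂ} (hA : 0 < A.re) :
    IntegrableOn (fun t : ℝ => ((t ^ 2 : ℝ) : ℂ)⁻¹ * Complex.exp (-A / (4 * t))) (Ioi 0) := by
  have hA' : 0 < ((A.re : ℝ) : ℂ).re := by simpa using hA
  obtain ⟨F, F0, Fp, cF, dF⟩ := exp_primitive hA'
  have hreal : ∀ t : ℝ, (((t ^ 2 : ℝ) : ℂ)⁻¹ * Complex.exp (-((A.re : ℝ) : ℂ) / (4 * t))) =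
      (((t ^ 2)⁻¹ * Real.exp (-A.re / (4 * t)) : ℝ) : ℂ) := fun t => by push_cast; rfl
  have h1 : IntegrableOn (fun t : ℝ => (t ^ 2)⁻¹ * Real.exp (-A.re / (4 * t))) (Ioi 0) := by
    refine integrableOn_Ioi_deriv_of_nonneg (g := fun t => (F t).re) (l := (4 / (A.re : ℂ)).re)
      (Complex.continuous_re.comp cF).continuousWithinAt (fun t ht => ?_) (fun t ht => ?_) ?_
    · have := (dF t ht)
      rw [hreal] at this
      exact Complex.reCLM.hasFDerivAt.comp_hasDerivAt t this
    · positivity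
    · refine (Complex.continuous_re.tendsto _).comp ((tendsto_exp_primitive (A.re : ℂ)).congr' ?_)
      filter_upwards [Filter.eventually_gt_atTop 0] with t ht using (Fp t ht).symm
  refine Integrable.mono' h1 (Measurable.aestronglyMeasurable (by fun_prop)) ?_
  exact ae_of_all _ fun t => (norm_inv_sq_mul_exp A).le

theorem integral_Ioi_exp_primitive {A : ℂ} (hA : 0 < A.re) :
    ∫ t in Ioi (0 : ℝ), ((t ^ 2 : ℝ) : ℂ)⁻¹ * Complex.exp (-A / (4 * t)) = 4 / A := by
  obtain ⟨F, F0, Fp, cF, dF⟩ := exp_primitive hA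
  rw [integral_Ioi_of_hasDerivAt_of_tendsto (m := 4 / A) cF.continuousWithinAt (fun t ht => dF t ht)
    (integrableOn_exp_primitive hA) ?_, F0, sub_zero]
  refine (tendsto_exp_primitive A).congr' ?_
  filter_upwards [Filter.eventually_gt_atTop 0] with t ht using (Fp t ht).symm

theorem integral_Ioo_exp_primitive {A : ℂ} (hA : 0 < A.re) {T : ℝ} (hT : 0 < T) :
    ∫ t in Ioo (0 : ℝ) T, ((t ^ 2 : ℝ) : ℂ)⁻¹ * Complex.exp (-A / (4 * t)) =
      4 / A * Complex.exp (-A / (4 * T)) := by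
  obtain ⟨F, F0, Fp, cF, dF⟩ := exp_primitive hA
  rw [← integral_Ioc_eq_integral_Ioo, ← intervalIntegral.integral_of_le hT.le,
    intervalIntegral.integral_eq_sub_of_hasDerivAt_of_le hT.le cF.continuousOn
      (fun t ht => dF t ht.1) ?_, F0, sub_zero, Fp T hT]
  rw [intervalIntegrable_iff_integrableOn_Ioc_of_le hT.le]
  exact (integrableOn_exp_primitive hA).mono_set Ioc_subset_Ioi_self

/-! ### States emitted by sources outside `[-L, L]` -/

/-- Source points and exponents for which `(x - z)² + c` stays in a right half-plane, uniformly for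
`x ∈ [-L, L]`. -/
structure AdmissibleSource {Y : Type*} [MeasurableSpace Y] (L δ Z : ℝ) (z : Y → ℝ) (c : Y → ℂ) :
    Prop where
  pos : 0 < δ
  meas_z : Measurable z
  meas_c : Measurable c
  bound_z : ∀ y, |z y| ≤ Z
  bound_c : ∀ y, ‖c y‖ ≤ Z
  sep : ∀ y, ∀ x ∈ Icc (-L) L, δ ≤ (x - z y) ^ 2
  re : ∀ y, ∀ x ∈ Icc (-L) L, δ ≤ (x - z y) ^ 2 + (c y).re

/-- A source fired at time `T - t` has amplitude fixed by `t`, but is observed after a delay `t' ≤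
t`. If `γ ≤ 0`, replacing `t` by `t'` in the amplitude only increases it, and `X² + γ ≥ δ` applies;
if `γ ≥ 0`, the amplitude exponential is at most one and `X² ≥ δ` suffices. This is why both lower
bounds are needed in `AdmissibleSource`. -/
theorem profile_weight_le {δ X γ t t' a b : ℝ} (hδ : 0 < δ) (h1 : δ ≤ X ^ 2) (h2 : δ ≤ X ^ 2 + γ)
    (ha : 0 ≤ a) (hab : a + b = 2) (ht' : 0 < t') (htt : t' ≤ t) :
    t ^ (-a) * Real.exp (-γ / (4 * t)) * gaussProfile b t' X ≤ 2 / (δ / 4) ^ 2 := by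
  have ht : 0 < t := ht'.trans_le htt
  have hp : t ^ (-a) ≤ t' ^ (-a) := Real.rpow_le_rpow_of_nonpos ht' htt (by linarith)
  have he : Real.exp (-γ / (4 * t)) * Real.exp (-(X ^ 2 / 4 / t')) ≤ Real.exp (-(δ / 4 / t')) := by
    rw [← Real.exp_add]
    apply Real.exp_le_exp.2
    rcases le_total 0 γ with hγ | hγ
    · have e1 : -γ / (4 * t) ≤ 0 := div_nonpos_of_nonpos_of_nonneg (by linarith) (by positivity)
      have e2 : δ / 4 / t' ≤ X ^ 2 / 4 / t' := by gcongr
      linarith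
    · have e1 : -γ / (4 * t) ≤ -γ / (4 * t') :=
        div_le_div_of_nonneg_left (by linarith) (by positivity) (by linarith)
      have e2 : δ / 4 / t' ≤ (X ^ 2 + γ) / 4 / t' := by gcongr
      have e3 : (X ^ 2 + γ) / 4 / t' = X ^ 2 / 4 / t' - -γ / (4 * t') := by
        field_simp
        ring
      linarith
  have e : t' ^ (-a) * t' ^ (-b) = (t' ^ 2)⁻¹ := by
    rw [← Real.rpow_add ht', show -a + -b = -(2 : ℝ) by linarith, Real.rpow_neg ht'.le,
      Real.rpow_two]
  have h := pow_mul_exp_neg_le (a := δ / 4) (by positivity) 2 0 ht'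
  rw [gaussProfile_of_pos b X ht']
  calc t ^ (-a) * Real.exp (-γ / (4 * t)) * (t' ^ (-b) * Real.exp (-(X ^ 2 / 4 / t')))
      = t ^ (-a) * t' ^ (-b) * (Real.exp (-γ / (4 * t)) * Real.exp (-(X ^ 2 / 4 / t'))) := by ring
    _ ≤ t' ^ (-a) * t' ^ (-b) * Real.exp (-(δ / 4 / t')) := by gcongr
    _ = Real.exp (-(δ / 4 / t')) / t' ^ 2 := by rw [e]; ring
    _ ≤ _ := by simpa using h

/-- At the final time the delay equals `t`, and `a + b = 2` produces exactly the integrand whose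
primitive is known. -/
theorem profile_weight_diag (X : ℝ) (c : ℂ) {t a b : ℝ} (hab : a + b = 2) (ht : 0 < t) :
    ((t ^ (-a) : ℝ) : ℂ) * Complex.exp (-c / (4 * t)) * (gaussProfile b t X : ℂ) =
      ((t ^ 2 : ℝ) : ℂ)⁻¹ * Complex.exp (-(((X ^ 2 : ℝ) : ℂ) + c) / (4 * t)) := by
  have ht' : (t : ℂ) ≠ 0 := by exact_mod_cast ht.ne'
  have e : t ^ (-a) * t ^ (-b) = (t ^ 2)⁻¹ := by
    rw [← Real.rpow_add ht, show -a + -b = -(2 : ℝ) by linarith, Real.rpow_neg ht.le,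
      Real.rpow_two]
  have e2 : -(((X ^ 2 : ℝ) : ℂ) + c) / (4 * t) = -c / (4 * t) + ((-(X ^ 2 / 4 / t) : ℝ) : ℂ) := by
    push_cast
    field_simp
    ring
  rw [gaussProfile_of_pos b X ht, e2, Complex.exp_add, ← Complex.ofReal_inv, ← e,
    ← Complex.ofReal_exp]
  push_cast
  ring

/-- Superposition of the causal kernels `κ`, acting during the last `T` units of time. -/
theorem bddReachable_truncated {Y : Type*} [MeasurableSpace Y] {m : Measure Y} [SFinite m]
    {κ κt κx : ℝ → ℝ → ℝ} (hκ : CausalKernel κ κt κx) {e : ℕ} {a b : ℝ} (ha : 0 ≤ a)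
    (hab : a + b = 2) (hform : ∀ t x, κ t x = x ^ e * gaussProfile b t x)
    {L T δ Z : ℝ} (hL : 0 < L) (hT : 0 < T) {z : Y → ℝ} {c : Y → ℂ}
    (hzc : AdmissibleSource L δ Z z c) {β : Y → ℂ} (hβ : Measurable β) (hβi : Integrable β m) :
    BddReachable L T fun x => ∫ y, β y * (((x - z y : ℝ) : ℂ) ^ e *
      (4 / (((x - z y) ^ 2 : ℝ) + c y) *
        Complex.exp (-(((x - z y) ^ 2 : ℝ) + c y) / (4 * T)))) ∂m := by
  -- The label `(y, t)` stands for a source at `z y` that fires at time `T - t`; by causality each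
  -- such solution starts from zero.
  set U : Y × ℝ → ℝ → ℝ → ℂ := fun θ s x =>
    (β θ.1 * (((θ.2 ^ (-a) : ℝ) : ℂ) * Complex.exp (-c θ.1 / (4 * θ.2)))) *
      (κ (s - (T - θ.2)) (x - z θ.1) : ℝ) with hU
  set ν : Measure (Y × ℝ) := m.prod (volume.restrict (Ioo 0 T)) with hν
  have hδ := hzc.pos
  have mz := hzc.meas_z
  have mc := hzc.meas_c
  have mem : ∀ᵐ θ ∂ν, θ.2 ∈ Ioo 0 T :=
    Measure.quasiMeasurePreserving_snd.ae (ae_restrict_mem measurableSet_Ioo)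
  have hUm : Measurable fun q : (Y × ℝ) × ℝ × ℝ => U q.1 q.2.1 q.2.2 := by
    have mκ : Measurable fun p : ℝ × ℝ => κ p.1 p.2 := by
      simp only [hform]
      exact (by fun_prop : Measurable fun p : ℝ × ℝ => p.2 ^ e).mul (measurable_gaussProfile b)
    have m1 : Measurable fun q : (Y × ℝ) × ℝ × ℝ =>
        κ (q.2.1 - (T - q.1.2)) (q.2.2 - z q.1.1) :=
      mκ.comp (by fun_prop : Measurable fun q : (Y × ℝ) × ℝ × ℝ =>
        (q.2.1 - (T - q.1.2), q.2.2 - z q.1.1))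
    fun_prop
  set B : ℝ := (L + Z) ^ e * (2 / (δ / 4) ^ 2) with hB
  have hgi : Integrable (fun θ : Y × ℝ => ‖β θ.1‖ * B) ν :=
    hβi.norm.mul_prod (integrable_const B)
  have hbound : ∀ θ : Y × ℝ, θ.2 ∈ Ioo 0 T → ∀ s ∈ Icc 0 T, ∀ x ∈ Icc (-L) L,
      ‖U θ s x‖ ≤ ‖β θ.1‖ * B := by
    rintro ⟨y, t⟩ ht s hs x hx
    have hZ0 : 0 ≤ L + Z := by linarith [(abs_nonneg _).trans (hzc.bound_z y)]
    have hnorm : ‖U (y, t) s x‖ = ‖β y‖ * (|x - z y| ^ e * (t ^ (-a) *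
        Real.exp (-(c y).re / (4 * t)) * gaussProfile b (s - (T - t)) (x - z y))) := by
      simp only [hU, hform]
      rw [norm_mul, norm_mul, norm_mul, Complex.norm_exp, re_neg_div_four_mul, Complex.norm_real,
        Complex.norm_real, Real.norm_of_nonneg (Real.rpow_nonneg ht.1.le _), norm_mul, norm_pow,
        Real.norm_eq_abs, Real.norm_of_nonneg (gaussProfile_nonneg _ _ _)]
      ring
    rw [hnorm, hB]
    have hxz : |x - z y| ≤ L + Z := (abs_sub _ _).trans (add_le_add (abs_le.2 hx) (hzc.bound_z y))
    rcases lt_or_ge 0 (s - (T - t)) with h | h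
    · have := profile_weight_le (t := t) hδ (hzc.sep y x hx) (hzc.re y x hx) ha hab h
        (by linarith [hs.2])
      have h0 : 0 ≤ t ^ (-a) * Real.exp (-(c y).re / (4 * t)) *
          gaussProfile b (s - (T - t)) (x - z y) :=
        mul_nonneg (mul_nonneg (Real.rpow_nonneg ht.1.le _) (Real.exp_pos _).le)
          (gaussProfile_nonneg _ _ _)
      gcongr
    · rw [gaussProfile_of_nonpos _ _ h, mul_zero, mul_zero, mul_zero]
      positivity
  refine ⟨_, BoundedWeakSolution.of_superposition (ν := ν) (T := T) hL hUm hgi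
    (mem.mono fun θ hθ => hbound θ hθ) ?_, ?_⟩
  · filter_upwards [mem] with θ hθ τ hτ φ hφ hb
    refine hκ.weakIdentity hL (by linarith [hθ.2]) (fun x hx h0 => ?_) _ hτ hφ hb
    have := hzc.sep θ.1 x hx
    rw [h0] at this
    norm_num at this
    linarith
  · intro x hx
    have hx' := Ioo_subset_Icc_self hx
    have hi : Integrable (fun θ => U θ T x) ν := by
      refine hgi.mono'
        (hUm.comp (by fun_prop : Measurable fun θ : Y × ℝ => (θ, T, x))).aestronglyMeasurable ?_
      exact mem.mono fun θ hθ => hbound θ hθ T (right_mem_Icc.2 hT.le) x hx'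
    rw [hν, integral_prod _ hi]
    refine integral_congr_ae (ae_of_all _ fun y => ?_)
    have hre : 0 < ((((x - z y) ^ 2 : ℝ) : ℂ) + c y).re := by
      rw [Complex.add_re, Complex.ofReal_re]
      exact hδ.trans_le (hzc.re y x hx')
    simp only
    rw [← integral_Ioo_exp_primitive hre hT, ← integral_const_mul, ← integral_const_mul]
    refine setIntegral_congr_fun measurableSet_Ioo fun t ht => ?_
    have hd := profile_weight_diag (x - z y) (c y) hab ht.1
    simp only [hU, hform]
    rw [show T - (T - t) = t by ring, ← hd]
    push_cast
    ring

/-- Integrals of entire functions with locally uniform integrable bounds are entire. -/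
theorem differentiable_integral_of_entire {Y : Type*} [MeasurableSpace Y] {m : Measure Y}
    {f : ℂ → Y → ℂ} {g : Y → ℝ} {Φ : ℝ → ℝ} (hg : Integrable g m)
    (hmeas : ∀ ζ, AEStronglyMeasurable (f ζ) m) (hf : ∀ y, Differentiable ℂ fun ζ => f ζ y)
    (hbound : ∀ ρ ζ, ‖ζ‖ ≤ ρ → ∀ y, ‖f ζ y‖ ≤ Φ ρ * g y) :
    Differentiable ℂ fun ζ => ∫ y, f ζ y ∂m := by
  intro ζ₀
  have hder : ∀ y ζ, HasDerivAt (fun ζ => f ζ y) (deriv (fun ζ => f ζ y) ζ) ζ := fun y ζ =>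
    (hf y ζ).hasDerivAt
  refine (hasDerivAt_integral_of_dominated_loc_of_deriv_le (s := Metric.ball ζ₀ 1)
    (F' := fun ζ y => deriv (fun ζ => f ζ y) ζ) (bound := fun y => Φ (‖ζ₀‖ + 2) * g y)
    (Metric.ball_mem_nhds _ one_pos) (Filter.Eventually.of_forall hmeas) ?_ ?_ ?_
    (hg.const_mul _) (ae_of_all _ fun y ζ _ => hder y ζ)).2.differentiableAt
  · exact (hg.const_mul (Φ ‖ζ₀‖)).mono' (hmeas ζ₀) (ae_of_all _ fun y => hbound _ ζ₀ le_rfl y)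
  -- Measurability of the derivative in the parameter, as a limit of difference quotients along `1 /
  -- (n + 1)`.
  · have hlim : Filter.Tendsto (fun n : ℕ => ((1 : ℂ) / ((n : ℂ) + 1))) Filter.atTop
        (nhdsWithin 0 {0}ᶜ) := by
      rw [tendsto_nhdsWithin_iff]
      refine ⟨tendsto_one_div_add_atTop_nhds_zero_nat, Filter.Eventually.of_forall fun n => ?_⟩
      have : ((n : ℂ) + 1) ≠ 0 := Nat.cast_add_one_ne_zero n
      simpa using this
    refine aestronglyMeasurable_of_tendsto_ae Filter.atTop
      (f := fun (n : ℕ) y => ((1 : ℂ) / ((n : ℂ) + 1))⁻¹ •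
        (f (ζ₀ + (1 : ℂ) / ((n : ℂ) + 1)) y - f ζ₀ y))
      (fun n => ((hmeas (ζ₀ + (1 : ℂ) / ((n : ℂ) + 1))).sub (hmeas ζ₀)).const_smul
        ((1 : ℂ) / ((n : ℂ) + 1))⁻¹) (ae_of_all _ fun y => ?_)
    exact ((hasDerivAt_iff_tendsto_slope_zero.1 (hder y ζ₀)).comp hlim)
  · refine ae_of_all _ fun y ζ hζ => ?_
    have h := Complex.norm_deriv_le_of_forall_mem_sphere_norm_le (c := ζ) (R := 1)
      (C := Φ (‖ζ₀‖ + 2) * g y) one_pos (hf y).diffContOnCl fun w hw => by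
        refine hbound _ w ?_ y
        rw [mem_sphere_iff_norm] at hw
        rw [Metric.mem_ball, dist_eq_norm] at hζ
        calc ‖w‖ = ‖(w - ζ) + (ζ - ζ₀) + ζ₀‖ := by congr 1; ring
          _ ≤ ‖w - ζ‖ + ‖ζ - ζ₀‖ + ‖ζ₀‖ := norm_add₃_le
          _ ≤ ‖ζ₀‖ + 2 := by linarith
    simpa using h

/-- The entire function `4 (1 - exp (-w / 4T)) / w`. -/
def expRemainder (T : ℝ) (w : ℂ) : ℂ := -4 * dslope (fun w : ℂ => Complex.exp (-w / (4 * T))) 0 w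

theorem expRemainder_of_ne (T : ℝ) {w : ℂ} (hw : w ≠ 0) :
    expRemainder T w = 4 / w - 4 / w * Complex.exp (-w / (4 * T)) := by
  rw [expRemainder, dslope_of_ne _ hw, slope_def_field]
  simp only [neg_zero, zero_div, Complex.exp_zero, sub_zero]
  field_simp
  ring

theorem differentiable_expRemainder (T : ℝ) : Differentiable ℂ (expRemainder T) := by
  have h : DifferentiableOn ℂ (dslope (fun w : ℂ => Complex.exp (-w / (4 * T))) 0) univ :=
    (Complex.differentiableOn_dslope Filter.univ_mem).2
      (by fun_prop : Differentiable ℂ fun w : ℂ => Complex.exp (-w / (4 * T))).differentiableOn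
  exact (differentiableOn_univ.1 h).const_mul (-4)

/-- Mean value inequality on the disc of radius `‖w‖`; it avoids any loss near the removable
singularity. -/
theorem norm_expRemainder_le {T : ℝ} (hT : 0 < T) (w : ℂ) :
    ‖expRemainder T w‖ ≤ 1 / T * Real.exp (‖w‖ / (4 * T)) := by
  have hder : ∀ v : ℂ, HasDerivAt (fun w : ℂ => Complex.exp (-w / (4 * T)))
      (Complex.exp (-v / (4 * T)) * (-1 / (4 * T))) v := fun v =>
    ((hasDerivAt_id v).neg.div_const (4 * T : ℂ)).cexp
  have h4 : ‖(-1 / (4 * T) : ℂ)‖ = 1 / (4 * T) := by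
    rw [show (-1 / (4 * T) : ℂ) = ((-1 / (4 * T) : ℝ) : ℂ) by push_cast; ring, Complex.norm_real,
      Real.norm_eq_abs, abs_div, abs_neg, abs_one, abs_of_pos (by positivity)]
  have hnd : ∀ v : ℂ, ‖v‖ ≤ ‖w‖ → ‖Complex.exp (-v / (4 * T)) * (-1 / (4 * T))‖ ≤
      Real.exp (‖w‖ / (4 * T)) * (1 / (4 * T)) := by
    intro v hv
    rw [norm_mul, h4, Complex.norm_exp, re_neg_div_four_mul]
    gcongr
    exact (neg_le_abs _).trans ((Complex.abs_re_le_norm v).trans hv)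
  have key : ‖dslope (fun w : ℂ => Complex.exp (-w / (4 * T))) 0 w‖ ≤
      Real.exp (‖w‖ / (4 * T)) * (1 / (4 * T)) := by
    rcases eq_or_ne w 0 with rfl | hw
    · rw [dslope_same, (hder 0).deriv]
      exact hnd 0 le_rfl
    · have h := (convex_closedBall (0 : ℂ) ‖w‖).norm_image_sub_le_of_norm_hasDerivWithin_le
        (fun v _ => (hder v).hasDerivWithinAt) (fun v hv => hnd v (by simpa using hv))
        (x := 0) (y := w) (by simp) (by simp)
      rw [dslope_of_ne _ hw, slope_def_field, norm_div, div_le_iff₀ (by simpa using hw)]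
      exact h
  rw [expRemainder, norm_mul, norm_neg, Complex.norm_ofNat]
  calc 4 * _ ≤ 4 * (Real.exp (‖w‖ / (4 * T)) * (1 / (4 * T))) := by gcongr
    _ = _ := by field_simp

/-- The part of the state that was emitted before the last `T` units of time. -/
theorem bddReachable_remainder {Y : Type*} [MeasurableSpace Y] {m : Measure Y} (e : ℕ)
    {L T δ Z : ℝ} (hL : 0 < L) (hT : 0 < T) {z : Y → ℝ} {c : Y → ℂ}
    (hzc : AdmissibleSource L δ Z z c) {β : Y → ℂ} (hβi : Integrable β m) :
    BddReachable L T fun x => ∫ y, β y * (((x - z y : ℝ) : ℂ) ^ e *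
      expRemainder T (((x - z y) ^ 2 : ℝ) + c y)) ∂m := by
  have mz := hzc.meas_z
  have mc := hzc.meas_c
  have mE : Measurable (expRemainder T) := (differentiable_expRemainder T).continuous.measurable
  set f : ℂ → Y → ℂ := fun ζ y => β y * ((ζ - z y) ^ e * expRemainder T ((ζ - z y) ^ 2 + c y))
    with hf
  have hpt : ∀ ρ ζ, ‖ζ‖ ≤ ρ → ∀ y, ‖f ζ y‖ ≤
      ((ρ + |Z|) ^ e * (1 / T * Real.exp (((ρ + |Z|) ^ 2 + |Z|) / (4 * T)))) * ‖β y‖ := by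
    intro ρ ζ hζ y
    have hρ : 0 ≤ ρ := (norm_nonneg _).trans hζ
    have h1 : ‖ζ - z y‖ ≤ ρ + |Z| := by
      refine (norm_sub_le _ _).trans (add_le_add hζ ?_)
      rw [Complex.norm_real]
      exact (hzc.bound_z y).trans (le_abs_self Z)
    have h2 : ‖(ζ - z y) ^ 2 + c y‖ ≤ (ρ + |Z|) ^ 2 + |Z| := by
      refine (norm_add_le _ _).trans (add_le_add ?_ ((hzc.bound_c y).trans (le_abs_self Z)))
      rw [norm_pow]
      gcongr
    simp only [hf]
    rw [norm_mul, norm_mul, norm_pow, mul_comm]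
    have h3 := norm_expRemainder_le hT ((ζ - z y) ^ 2 + c y)
    have h4 : Real.exp (‖(ζ - z y) ^ 2 + c y‖ / (4 * T)) ≤
        Real.exp (((ρ + |Z|) ^ 2 + |Z|) / (4 * T)) := by gcongr
    gcongr
    exact h3.trans (by gcongr)
  have hdiff : Differentiable ℂ fun ζ => ∫ y, f ζ y ∂m := by
    refine differentiable_integral_of_entire hβi.norm (fun ζ => ?_) (fun y => ?_) hpt
    · refine hβi.aestronglyMeasurable.mul (Measurable.aestronglyMeasurable ?_)
      have : Measurable fun y => expRemainder T ((ζ - z y) ^ 2 + c y) :=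
        mE.comp (by fun_prop)
      fun_prop
    · have : Differentiable ℂ fun ζ : ℂ => expRemainder T ((ζ - z y) ^ 2 + c y) :=
        (differentiable_expRemainder T).comp (by fun_prop)
      fun_prop
  set Cβ : ℝ := ∫ y, ‖β y‖ ∂m with hCβ
  have hCβ0 : 0 ≤ Cβ := integral_nonneg fun y => norm_nonneg _
  have hgrow : ∀ ζ, ‖∫ y, f ζ y ∂m‖ ≤ ((1 / T * Real.exp ((2 * |Z| ^ 2 + |Z|) / (4 * T))) *
      (Real.exp (e * (1 + |Z|))) * Cβ) * Real.exp ((e + 2 / (4 * T)) * ‖ζ‖ ^ 2) := by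
    intro ζ
    have h := norm_integral_le_of_norm_le (hβi.norm.const_mul _)
      (ae_of_all m fun y => hpt ‖ζ‖ ζ le_rfl y)
    rw [integral_const_mul] at h
    refine h.trans ?_
    -- The polynomial factor is absorbed into a Gaussian through `‖ζ‖ ≤ 1 + ‖ζ‖²`.
    have h1 : (‖ζ‖ + |Z|) ^ e ≤ Real.exp (e * (1 + |Z|)) * Real.exp (e * ‖ζ‖ ^ 2) := by
      rw [← Real.exp_add, ← mul_add, Real.exp_nat_mul]
      gcongr
      have := Real.add_one_le_exp (1 + |Z| + ‖ζ‖ ^ 2)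
      nlinarith [sq_nonneg (‖ζ‖ - 1)]
    have h2 : Real.exp (((‖ζ‖ + |Z|) ^ 2 + |Z|) / (4 * T)) ≤
        Real.exp ((2 * |Z| ^ 2 + |Z|) / (4 * T)) * Real.exp (2 / (4 * T) * ‖ζ‖ ^ 2) := by
      rw [← Real.exp_add]
      apply Real.exp_le_exp.2
      rw [div_mul_eq_mul_div, ← add_div]
      refine div_le_div_of_nonneg_right ?_ (by positivity)
      nlinarith [sq_nonneg (‖ζ‖ - |Z|)]
    calc (‖ζ‖ + |Z|) ^ e * (1 / T * Real.exp (((‖ζ‖ + |Z|) ^ 2 + |Z|) / (4 * T))) * Cβ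
        ≤ (Real.exp (e * (1 + |Z|)) * Real.exp (e * ‖ζ‖ ^ 2)) * (1 / T *
          (Real.exp ((2 * |Z| ^ 2 + |Z|) / (4 * T)) * Real.exp (2 / (4 * T) * ‖ζ‖ ^ 2))) * Cβ := by
          gcongr
      _ = _ := by rw [add_mul, Real.exp_add]; ring
  refine (bddReachable_of_entire hL hT hdiff hgrow).congr fun x _ => ?_
  refine integral_congr_ae (ae_of_all _ fun y => ?_)
  simp only [hf]
  push_cast
  rfl

/-- States emitted by point sources outside `[-L, L]` over an infinite time are reachable in every
time. -/
theorem bddReachable_of_kernel {Y : Type*} [MeasurableSpace Y] {m : Measure Y} [SFinite m]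
    {κ κt κx : ℝ → ℝ → ℝ} (hκ : CausalKernel κ κt κx) {e : ℕ} {a b : ℝ} (ha : 0 ≤ a)
    (hab : a + b = 2) (hform : ∀ t x, κ t x = x ^ e * gaussProfile b t x)
    {L T δ Z : ℝ} (hL : 0 < L) (hT : 0 < T) {z : Y → ℝ} {c : Y → ℂ}
    (hzc : AdmissibleSource L δ Z z c) {β : Y → ℂ} (hβ : Measurable β) (hβi : Integrable β m) :
    BddReachable L T fun x => ∫ y, β y * (((x - z y : ℝ) : ℂ) ^ e /
      (((x - z y) ^ 2 : ℝ) + c y)) ∂m := by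
  have mz := hzc.meas_z
  have mc := hzc.meas_c
  have mE : Measurable (expRemainder T) := (differentiable_expRemainder T).continuous.measurable
  have hδ := hzc.pos
  -- The time integral gives `4 / A`; dividing the density by `4` normalizes it to `1 / A`.
  have hβ4 : Integrable (fun y => β y / 4) m := hβi.div_const 4
  refine ((bddReachable_truncated hκ ha hab hform hL hT hzc (hβ.div_const 4) hβ4).add hL
    (bddReachable_remainder e hL hT hzc hβ4)).congr fun x hx => ?_
  have hx' := Ioo_subset_Icc_self hx
  have hre : ∀ y, δ ≤ ((((x - z y) ^ 2 : ℝ) : ℂ) + c y).re := fun y => by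
    rw [Complex.add_re, Complex.ofReal_re]
    exact hzc.re y x hx'
  have hA : ∀ y, ((((x - z y) ^ 2 : ℝ) : ℂ) + c y) ≠ 0 := fun y h => by
    have := hre y
    rw [h, Complex.zero_re] at this
    linarith
  have hxz : ∀ y, ‖((x - z y : ℝ) : ℂ) ^ e‖ ≤ (L + |Z|) ^ e := by
    intro y
    rw [norm_pow, Complex.norm_real, Real.norm_eq_abs]
    gcongr
    exact (abs_sub _ _).trans (add_le_add (abs_le.2 hx') ((hzc.bound_z y).trans (le_abs_self Z)))
  have h4 : ∀ y, ‖(4 : ℂ) / (((x - z y) ^ 2 : ℝ) + c y) *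
      Complex.exp (-(((x - z y) ^ 2 : ℝ) + c y) / (4 * T))‖ ≤ 4 / δ := by
    intro y
    rw [norm_mul, norm_div, Complex.norm_exp, re_neg_div_four_mul, Complex.norm_ofNat]
    have h1 : δ ≤ ‖(((x - z y) ^ 2 : ℝ) + c y : ℂ)‖ := (hre y).trans (Complex.re_le_norm _)
    have h2 : Real.exp (-((((x - z y) ^ 2 : ℝ) : ℂ) + c y).re / (4 * T)) ≤ 1 := by
      rw [Real.exp_le_one_iff]
      exact div_nonpos_of_nonpos_of_nonneg (by linarith [hre y]) (by positivity)
    calc _ ≤ 4 / δ * 1 := by gcongr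
      _ = _ := mul_one _
  have h5 : ∀ y, ‖(4 : ℂ) / (((x - z y) ^ 2 : ℝ) + c y)‖ ≤ 4 / δ := by
    intro y
    rw [norm_div, Complex.norm_ofNat]
    have h1 : δ ≤ ‖(((x - z y) ^ 2 : ℝ) + c y : ℂ)‖ := (hre y).trans (Complex.re_le_norm _)
    gcongr
  have i1 : Integrable (fun y => β y / 4 * (((x - z y : ℝ) : ℂ) ^ e *
      (4 / (((x - z y) ^ 2 : ℝ) + c y) *
        Complex.exp (-(((x - z y) ^ 2 : ℝ) + c y) / (4 * T))))) m := by
    refine hβ4.mul_bdd (c := (L + |Z|) ^ e * (4 / δ)) (Measurable.aestronglyMeasurable (by fun_prop))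
      (ae_of_all _ fun y => ?_)
    rw [norm_mul]
    exact mul_le_mul (hxz y) (h4 y) (norm_nonneg _) (by positivity)
  have i2 : Integrable (fun y => β y / 4 * (((x - z y : ℝ) : ℂ) ^ e *
      expRemainder T (((x - z y) ^ 2 : ℝ) + c y))) m := by
    refine hβ4.mul_bdd (c := (L + |Z|) ^ e * (4 / δ + 4 / δ))
      (Measurable.aestronglyMeasurable ?_) (ae_of_all _ fun y => ?_)
    · have : Measurable fun y => expRemainder T (((x - z y) ^ 2 : ℝ) + c y) :=
        mE.comp (by fun_prop)
      fun_prop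
    · rw [norm_mul, expRemainder_of_ne T (hA y)]
      exact mul_le_mul (hxz y) ((norm_sub_le _ _).trans (add_le_add (h5 y) (h4 y)))
        (norm_nonneg _) (by positivity)
  rw [← integral_add i1 i2]
  refine integral_congr_ae (ae_of_all _ fun y => ?_)
  simp only
  rw [expRemainder_of_ne T (hA y)]
  ring

theorem AdmissibleSource.integrable {Y : Type*} [MeasurableSpace Y] {m : Measure Y}
    {L δ Z : ℝ} {z : Y → ℝ} {c : Y → ℂ} (hzc : AdmissibleSource L δ Z z c) (e : ℕ) {β : Y → ℂ}
    (hβi : Integrable β m) {x : ℝ} (hx : x ∈ Icc (-L) L) :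
    Integrable (fun y => β y * (((x - z y : ℝ) : ℂ) ^ e / (((x - z y) ^ 2 : ℝ) + c y))) m := by
  have mz := hzc.meas_z
  have mc := hzc.meas_c
  have hδ := hzc.pos
  refine hβi.mul_bdd (c := (|x| + |Z|) ^ e / δ) (Measurable.aestronglyMeasurable (by fun_prop))
    (ae_of_all _ fun y => ?_)
  have h1 : δ ≤ ‖(((x - z y) ^ 2 : ℝ) + c y : ℂ)‖ := by
    refine le_trans ?_ (Complex.re_le_norm _)
    rw [Complex.add_re, Complex.ofReal_re]
    exact hzc.re y x hx
  rw [norm_div, norm_pow, Complex.norm_real, Real.norm_eq_abs]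
  gcongr
  exact (abs_sub _ _).trans (add_le_add le_rfl ((hzc.bound_z y).trans (le_abs_self Z)))

/-- Superpositions of simple poles `p`, seen from sources at `z`, are reachable. -/
theorem bddReachable_of_poles {Y : Type*} [MeasurableSpace Y] {m : Measure Y} [SFinite m]
    {L T δ Z : ℝ} (hL : 0 < L) (hT : 0 < T) {z : Y → ℝ} {p : Y → ℂ} (hp : Measurable p)
    (hpb : ∀ y, ‖p y‖ ≤ Z)
    (hzc : AdmissibleSource L δ Z z fun y => -(p y - z y) ^ 2) {β : Y → ℂ} (hβ : Measurable β)
    (hβi : Integrable β m) :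
    (∀ x ∈ Ioo (-L) L, Integrable (fun y => β y / (x - p y)) m) ∧
      BddReachable L T fun x => ∫ y, β y / (x - p y) ∂m := by
  have mz := hzc.meas_z
  have hβ0 : Measurable fun y => β y * (p y - z y) := by fun_prop
  have hβ0i : Integrable (fun y => β y * (p y - z y)) m := by
    refine hβi.mul_bdd (c := Z + Z) (Measurable.aestronglyMeasurable (by fun_prop))
      (ae_of_all _ fun y => (norm_sub_le _ _).trans (add_le_add (hpb y) ?_))
    rw [Complex.norm_real]
    exact hzc.bound_z y
  -- With `X = x - z` and `P = p - z`: `1 / (X - P) = P / (X² - P²) + X / (X² - P²)`, a monopole and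
  -- a dipole at `z`.
  have hsplit : ∀ x ∈ Ioo (-L) L, ∀ y,
      (β y * (p y - z y)) * (((x - z y : ℝ) : ℂ) ^ 0 / (((x - z y) ^ 2 : ℝ) + -(p y - z y) ^ 2)) +
      β y * (((x - z y : ℝ) : ℂ) ^ 1 / (((x - z y) ^ 2 : ℝ) + -(p y - z y) ^ 2)) =
      β y / (x - p y) := by
    intro x hx y
    have hA : (((x - z y) ^ 2 : ℝ) + -(p y - z y) ^ 2 : ℂ) ≠ 0 := fun h => by
      have h1 := hzc.re y x (Ioo_subset_Icc_self hx)
      have h2 := congrArg Complex.re h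
      rw [Complex.add_re, Complex.ofReal_re, Complex.zero_re] at h2
      rw [h2] at h1
      linarith [hzc.pos]
    have hfac : (((x - z y) ^ 2 : ℝ) + -(p y - z y) ^ 2 : ℂ) =
        (x - p y) * ((x - z y) + (p y - z y)) := by
      push_cast
      ring
    rw [hfac] at hA ⊢
    have h1 := left_ne_zero_of_mul hA
    have h2 := right_ne_zero_of_mul hA
    push_cast
    field_simp
    ring
  refine ⟨fun x hx => ?_, ?_⟩
  · refine ((hzc.integrable 0 hβ0i (Ioo_subset_Icc_self hx)).add
      (hzc.integrable 1 hβi (Ioo_subset_Icc_self hx))).congr (ae_of_all _ fun y => ?_)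
    exact hsplit x hx y
  · refine ((bddReachable_of_kernel causalKernel_monopole (a := 3 / 2) (by norm_num) (by norm_num)
      (fun _ _ => rfl) hL hT hzc hβ0 hβ0i).add hL (bddReachable_of_kernel causalKernel_dipole
      (a := 1 / 2) (by norm_num) (by norm_num) (fun _ _ => rfl) hL hT hzc hβ hβi)).congr
      fun x hx => ?_
    rw [← integral_add (hzc.integrable 0 hβ0i (Ioo_subset_Icc_self hx))
      (hzc.integrable 1 hβi (Ioo_subset_Icc_self hx))]
    exact integral_congr_ae (ae_of_all _ fun y => hsplit x hx y)

/-! ### Relocating the sources: poles of the kernel -/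

/-- The denominator `(x - y)² + L₀² - y² - i α(y)`. -/
def cauchyDen (L₀ : ℝ) (α : ℝ → ℝ) (x y : ℝ) : ℂ :=
  (((x - y) ^ 2 + L₀ ^ 2 - y ^ 2 : ℝ) : ℂ) - Complex.I * (α y : ℂ)

theorem re_cauchyDen (L₀ : ℝ) (α : ℝ → ℝ) (x y : ℝ) :
    (cauchyDen L₀ α x y).re = (x - y) ^ 2 + L₀ ^ 2 - y ^ 2 := by
  rw [cauchyDen, Complex.sub_re, Complex.ofReal_re]
  simp

/-- The right side is `x² - 2xy + L₀² ≥ (L₀ - |x|)²`. -/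
theorem quadratic_lower_bound {L L₀ x y : ℝ} (hL₀ : L < L₀) (hx : x ∈ Icc (-L) L)
    (hy : y ∈ Icc (-L₀) L₀) : (L₀ - L) ^ 2 ≤ (x - y) ^ 2 + L₀ ^ 2 - y ^ 2 := by
  have hxy : x * y ≤ |x| * L₀ := by
    refine (le_abs_self _).trans ?_
    rw [abs_mul]
    gcongr
    exact abs_le.2 hy
  have hxL : |x| ≤ L := abs_le.2 hx
  nlinarith [sq_abs x]

theorem le_re_cauchyDen {L L₀ x y : ℝ} (hL₀ : L < L₀) (α : ℝ → ℝ) (hx : x ∈ Icc (-L) L)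
    (hy : y ∈ Icc (-L₀) L₀) : (L₀ - L) ^ 2 ≤ (cauchyDen L₀ α x y).re := by
  rw [re_cauchyDen]
  exact quadratic_lower_bound hL₀ hx hy

theorem measurable_cauchyDen {L₀ : ℝ} {α : ℝ → ℝ} (hα : Continuous α) (x : ℝ) :
    Measurable (cauchyDen L₀ α x) := by
  unfold cauchyDen
  fun_prop

theorem integrableOn_div_cauchyDen {L L₀ : ℝ} (hL₀ : L < L₀) {α : ℝ → ℝ} (hα : Continuous α)
    {h : ℝ → ℂ} (hh : IntegrableOn h (Ioo (-L₀) L₀)) {x : ℝ} (hx : x ∈ Icc (-L) L) :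
    IntegrableOn (fun y => h y / cauchyDen L₀ α x y) (Ioo (-L₀) L₀) := by
  have hδ : 0 < (L₀ - L) ^ 2 := by
    have : 0 < L₀ - L := by linarith
    positivity
  simp only [div_eq_mul_inv]
  refine Integrable.mul_bdd hh (c := ((L₀ - L) ^ 2)⁻¹)
    (measurable_cauchyDen hα x).inv.aestronglyMeasurable ?_
  filter_upwards [ae_restrict_mem measurableSet_Ioo] with y hy
  rw [norm_inv]
  gcongr
  exact (le_re_cauchyDen hL₀ α hx (Ioo_subset_Icc_self hy)).trans (Complex.re_le_norm _)

/-- The contribution of the sources near the end points `±L₀`, which lie outside `[-L, L]`. -/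
theorem bddReachable_outer {L L₀ T : ℝ} (hL : 0 < L) (hL₀ : L < L₀) (hT : 0 < T) {α : ℝ → ℝ}
    (hα : Continuous α) {h : ℝ → ℂ} (hm : Measurable h) (hh : IntegrableOn h (Ioo (-L₀) L₀)) :
    BddReachable L T fun x =>
      ∫ y in Ioo (-L₀) L₀ ∩ {y | (L + L₀) / 2 < |y|}, h y / cauchyDen L₀ α x y := by
  classical
  set S : Set ℝ := Ioo (-L₀) L₀ ∩ {y | (L + L₀) / 2 < |y|} with hS
  have mS : MeasurableSet S :=
    measurableSet_Ioo.inter (measurableSet_lt measurable_const measurable_norm)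
  obtain ⟨M, hM⟩ := isCompact_Icc.exists_bound_of_continuousOn (s := Icc (-L₀) L₀)
    (f := α) hα.continuousOn
  have hL₀0 : 0 < L₀ := hL.trans hL₀
  have hM0 : 0 ≤ M := (norm_nonneg _).trans (hM 0 ⟨by linarith, hL₀0.le⟩)
  -- Off `S` the values are dummies, chosen so that the admissibility bounds hold for every `y`.
  set z : ℝ → ℝ := fun y => if y ∈ S then y else L₀ with hz
  set c : ℝ → ℂ := fun y =>
    if y ∈ S then ((L₀ ^ 2 - y ^ 2 : ℝ) : ℂ) - Complex.I * (α y : ℂ) else 0 with hc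
  have hend : ∀ x ∈ Icc (-L) L, ((L₀ - L) / 2) ^ 2 ≤ (x - L₀) ^ 2 := by
    intro x hx
    have h1 : (L₀ - L) / 2 ≤ L₀ - x := by linarith [hx.2]
    rw [← neg_sub L₀ x, neg_sq]
    have : 0 ≤ (L₀ - L) / 2 := by linarith
    gcongr
  have hzc : AdmissibleSource L (((L₀ - L) / 2) ^ 2) (L₀ + L₀ ^ 2 + M) z c := by
    refine ⟨?_, ?_, ?_, ?_, ?_, ?_, ?_⟩
    · have : 0 < (L₀ - L) / 2 := by linarith
      positivity
    · exact Measurable.ite mS measurable_id measurable_const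
    · exact Measurable.ite mS (by fun_prop) measurable_const
    · intro y
      have hpos : L₀ ≤ L₀ + L₀ ^ 2 + M := by nlinarith
      simp only [hz]
      split_ifs with hy
      · exact (abs_le.2 (Ioo_subset_Icc_self hy.1)).trans hpos
      · rwa [abs_of_pos hL₀0]
    · intro y
      simp only [hc]
      split_ifs with hy
      · have hyI := Ioo_subset_Icc_self hy.1
        refine (norm_sub_le _ _).trans ?_
        rw [Complex.norm_real, norm_mul, Complex.norm_I, one_mul, Complex.norm_real]
        have h1 : ‖L₀ ^ 2 - y ^ 2‖ ≤ L₀ ^ 2 := by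
          rw [Real.norm_of_nonneg] <;> nlinarith [hyI.1, hyI.2]
        linarith [hM y hyI]
      · rw [norm_zero]
        positivity
    · intro y x hx
      simp only [hz]
      split_ifs with hy
      · have h1 : (L₀ - L) / 2 ≤ |x - y| := by
          have h2 : (L + L₀) / 2 < |y| := hy.2
          have h3 := abs_sub_abs_le_abs_sub y x
          rw [abs_sub_comm] at h3
          linarith [abs_le.2 hx]
        rw [← sq_abs (x - y)]
        have : 0 ≤ (L₀ - L) / 2 := by linarith
        gcongr
      · exact hend x hx
    · intro y x hx
      simp only [hz, hc]
      split_ifs with hy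
      · have h1 := quadratic_lower_bound hL₀ hx (Ioo_subset_Icc_self hy.1)
        have h2 : (((L₀ ^ 2 - y ^ 2 : ℝ) : ℂ) - Complex.I * (α y : ℂ)).re = L₀ ^ 2 - y ^ 2 := by
          rw [Complex.sub_re, Complex.ofReal_re]
          simp
        rw [h2]
        nlinarith [sq_nonneg (L₀ - L)]
      · simpa using hend x hx
  refine (bddReachable_of_kernel (m := volume.restrict S) causalKernel_monopole (a := 3 / 2)
    (by norm_num) (by norm_num) (fun _ _ => rfl) hL hT hzc hm
    (hh.mono_set inter_subset_left)).congr fun x hx => ?_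
  refine setIntegral_congr_fun mS fun y hy => ?_
  simp only [hz, hc, if_pos hy, cauchyDen]
  rw [pow_zero, ← mul_div_assoc, mul_one]
  congr 1
  push_cast
  ring

/-- The root `√(y² - L₀² + i α(y))`. -/
def denRoot (L₀ : ℝ) (α : ℝ → ℝ) (y : ℝ) : ℂ :=
  (((y ^ 2 - L₀ ^ 2 : ℝ) : ℂ) + Complex.I * (α y : ℂ)) ^ ((2 : ℂ)⁻¹)

theorem denRoot_sq (L₀ : ℝ) (α : ℝ → ℝ) (y : ℝ) :
    denRoot L₀ α y ^ 2 = ((y ^ 2 - L₀ ^ 2 : ℝ) : ℂ) + Complex.I * (α y : ℂ) :=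
  Complex.cpow_ofNat_inv_pow _ 2

theorem measurable_denRoot (L₀ : ℝ) {α : ℝ → ℝ} (hα : Continuous α) :
    Measurable (denRoot L₀ α) := by
  unfold denRoot
  exact Measurable.pow_const (by fun_prop) _

theorem cauchyDen_eq (L₀ : ℝ) (α : ℝ → ℝ) (x y : ℝ) :
    cauchyDen L₀ α x y = (x - (y + denRoot L₀ α y)) * (x - (y - denRoot L₀ α y)) := by
  have h := denRoot_sq L₀ α y
  rw [cauchyDen]
  push_cast at h ⊢
  linear_combination h

/-- Each of the two families of poles of the kernel is admissible, seen from the nearer of the two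
end points `±L₀`. -/
theorem bddReachable_inner_pole {L L₀ T : ℝ} (hL : 0 < L) (hL₀ : L < L₀) (hT : 0 < T) {α : ℝ → ℝ}
    (hα : Continuous α) {S : Set ℝ} (mS : MeasurableSet S) (hS : S ⊆ Icc (-L₀) L₀)
    (σ : ℂ) (hσ : σ ^ 2 = 1) {β : ℝ → ℂ} (hβ : Measurable β) (hβi : IntegrableOn β S) :
    (∀ x ∈ Ioo (-L) L, IntegrableOn (fun y => β y / (x - (y + σ * denRoot L₀ α y))) S) ∧
      BddReachable L T fun x => ∫ y in S, β y / (x - (y + σ * denRoot L₀ α y)) := by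
  classical
  obtain ⟨M, hM⟩ := isCompact_Icc.exists_bound_of_continuousOn (s := Icc (-L₀) L₀)
    (f := α) hα.continuousOn
  have hL₀0 : 0 < L₀ := hL.trans hL₀
  have hM0 : 0 ≤ M := (norm_nonneg _).trans (hM 0 ⟨by linarith, hL₀0.le⟩)
  have hσn : ‖σ‖ = 1 := by
    have := congrArg norm hσ
    rw [norm_pow, norm_one] at this
    exact (pow_eq_one_iff_of_nonneg (norm_nonneg σ) two_ne_zero).1 this
  have mr := measurable_denRoot L₀ hα
  set p : ℝ → ℂ := fun y => if y ∈ S then y + σ * denRoot L₀ α y else L₀ with hp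
  -- The end point on the same side as the pole. From `(p - y)² = y² - L₀² + iα(y)` and `z² = L₀²`
  -- one gets `Re (-(p - z)²) = 2 Re p (z - y)`, which this choice makes nonnegative.
  set z : ℝ → ℝ := fun y => if 0 ≤ (p y).re then L₀ else -L₀ with hz
  have mp : Measurable p := Measurable.ite mS (by fun_prop) measurable_const
  have mz : Measurable z :=
    Measurable.ite (measurableSet_le measurable_const (Complex.measurable_re.comp mp))
      measurable_const measurable_const
  have hpn : ∀ y, ‖p y‖ ≤ L₀ + (1 + L₀ ^ 2 + M) := by
    intro y
    simp only [hp]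
    split_ifs with hy
    · have hyI := hS hy
      have hr : ‖denRoot L₀ α y‖ ^ 2 ≤ L₀ ^ 2 + M := by
        rw [← norm_pow, denRoot_sq]
        refine (norm_add_le _ _).trans ?_
        rw [Complex.norm_real, norm_mul, Complex.norm_I, one_mul, Complex.norm_real]
        have h1 : ‖y ^ 2 - L₀ ^ 2‖ ≤ L₀ ^ 2 := by
          rw [norm_sub_rev, Real.norm_of_nonneg] <;> nlinarith [hyI.1, hyI.2]
        linarith [hM y hyI]
      refine (norm_add_le _ _).trans (add_le_add ?_ ?_)
      · rw [Complex.norm_real]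
        exact abs_le.2 hyI
      · rw [norm_mul, hσn, one_mul]
        nlinarith [sq_nonneg (‖denRoot L₀ α y‖ - 1)]
    · rw [Complex.norm_real, Real.norm_of_nonneg hL₀0.le]
      nlinarith
  have hzn : ∀ y, |z y| = L₀ := by
    intro y
    simp only [hz]
    split_ifs
    · exact abs_of_pos hL₀0
    · rw [abs_neg, abs_of_pos hL₀0]
  set P : ℝ := L₀ + (1 + L₀ ^ 2 + M) with hP
  have hP0 : 0 ≤ P := (norm_nonneg _).trans (hpn 0)
  have hsep : ∀ y, ∀ x ∈ Icc (-L) L, (L₀ - L) ^ 2 ≤ (x - z y) ^ 2 := by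
    intro y x hx
    have h1 : L₀ - L ≤ |x - z y| := by
      have h3 := abs_sub_abs_le_abs_sub (z y) x
      rw [abs_sub_comm, hzn] at h3
      linarith [abs_le.2 hx]
    rw [← sq_abs (x - z y)]
    have : 0 ≤ L₀ - L := by linarith
    gcongr
  have hpz : ∀ y, ‖(z y : ℂ)‖ = L₀ := fun y => by rw [Complex.norm_real, Real.norm_eq_abs, hzn]
  have hzc : AdmissibleSource L ((L₀ - L) ^ 2) (P + L₀ + (P + L₀) ^ 2) z
      fun y => -(p y - z y) ^ 2 := by
    refine ⟨?_, mz, by fun_prop, ?_, ?_, hsep, ?_⟩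
    · have : 0 < L₀ - L := by linarith
      positivity
    · intro y
      rw [hzn]
      nlinarith
    · intro y
      rw [norm_neg, norm_pow]
      have h1 : ‖p y - z y‖ ≤ P + L₀ := (norm_sub_le _ _).trans (add_le_add (hpn y) (hpz y).le)
      have h2 : ‖p y - z y‖ ^ 2 ≤ (P + L₀) ^ 2 := by gcongr
      linarith
    · intro y x hx
      refine (hsep y x hx).trans (le_add_of_nonneg_right ?_)
      by_cases hy : y ∈ S
      · have hyI := hS hy
        have hpy : p y = y + σ * denRoot L₀ α y := if_pos hy
        have hroot : (p y - y) ^ 2 = ((y ^ 2 - L₀ ^ 2 : ℝ) : ℂ) + Complex.I * (α y : ℂ) := by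
          rw [hpy, add_sub_cancel_left, mul_pow, hσ, one_mul, denRoot_sq]
        have hre := congrArg Complex.re hroot
        rw [Complex.add_re, Complex.ofReal_re] at hre
        simp only [sq, Complex.mul_re, Complex.sub_re, Complex.sub_im, Complex.ofReal_re,
          Complex.ofReal_im, Complex.I_re, Complex.I_im, zero_mul, one_mul, sub_zero,
          add_zero] at hre
        have hgoal : (-(p y - z y) ^ 2 : ℂ).re = 2 * (p y).re * (z y - y) + (L₀ ^ 2 - z y ^ 2) := by
          simp only [sq, Complex.neg_re, Complex.mul_re, Complex.sub_re, Complex.sub_im,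
            Complex.ofReal_re, Complex.ofReal_im, sub_zero]
          linarith
        have hz2 : z y ^ 2 = L₀ ^ 2 := by rw [← sq_abs, hzn]
        rw [hgoal, hz2, sub_self, add_zero]
        by_cases hpos : 0 ≤ (p y).re
        · have : z y = L₀ := if_pos hpos
          rw [this]
          have := hyI.2
          have h2 : 0 ≤ L₀ - y := by linarith
          positivity
        · have : z y = -L₀ := if_neg hpos
          rw [this]
          have := hyI.1
          nlinarith
      · have hpy : p y = L₀ := if_neg hy
        have hzy : z y = L₀ := if_pos (by rw [hpy]; exact hL₀0.le)
        rw [hpy, hzy]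
        simp
  have hmain := bddReachable_of_poles (m := volume.restrict S) hL hT mp
    (fun y => (hpn y).trans (by nlinarith)) hzc hβ hβi
  refine ⟨fun x hx => ?_, hmain.2.congr fun x hx => ?_⟩
  · refine IntegrableOn.congr_fun (hmain.1 x hx) (fun y hy => ?_) mS
    simp only [hp, if_pos hy]
  · refine setIntegral_congr_fun mS fun y hy => ?_
    simp only [hp, if_pos hy]

/-- The contribution of the sources that lie away from `±L₀`, by partial fractions. -/
theorem bddReachable_inner {L L₀ T : ℝ} (hL : 0 < L) (hL₀ : L < L₀) (hT : 0 < T) {α : ℝ → ℝ}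
    (hα : Continuous α) {h : ℝ → ℂ} (hm : Measurable h) (hh : IntegrableOn h (Ioo (-L₀) L₀)) :
    BddReachable L T fun x =>
      ∫ y in Ioo (-L₀) L₀ \ {y | (L + L₀) / 2 < |y|}, h y / cauchyDen L₀ α x y := by
  set S : Set ℝ := Ioo (-L₀) L₀ \ {y | (L + L₀) / 2 < |y|} with hS
  have mS : MeasurableSet S :=
    measurableSet_Ioo.diff (measurableSet_lt measurable_const measurable_norm)
  have hSI : S ⊆ Icc (-L₀) L₀ := fun y hy => Ioo_subset_Icc_self hy.1
  have mr := measurable_denRoot L₀ hα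
  -- Away from `±L₀` the root is bounded below, since `‖r‖² ≥ L₀² - y² ≥ η`; hence the partial
  -- fraction coefficient `1 / 2r` is bounded.
  set η : ℝ := L₀ ^ 2 - ((L + L₀) / 2) ^ 2 with hη
  have hη0 : 0 < η := by nlinarith
  have hrη : ∀ y ∈ S, η ≤ ‖denRoot L₀ α y‖ ^ 2 := by
    intro y hy
    have hy2 : |y| ≤ (L + L₀) / 2 := not_lt.1 hy.2
    rw [← norm_pow, denRoot_sq]
    refine le_trans ?_ ((Complex.abs_re_le_norm _))
    refine le_trans ?_ (neg_le_abs _)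
    simp only [Complex.add_re, Complex.ofReal_re, Complex.mul_re, Complex.I_re, Complex.I_im,
      Complex.ofReal_im, zero_mul, mul_zero, sub_self, add_zero]
    have : y ^ 2 ≤ ((L + L₀) / 2) ^ 2 := by
      rw [← sq_abs y]
      gcongr
    linarith
  have hr0 : ∀ y ∈ S, denRoot L₀ α y ≠ 0 := fun y hy h0 => by
    have := hrη y hy
    rw [h0, norm_zero] at this
    norm_num at this
    linarith
  set β : ℝ → ℂ := fun y => h y * (2 * denRoot L₀ α y)⁻¹ with hβ
  have mβ : Measurable β := by fun_prop
  have hβi : IntegrableOn β S := by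
    refine Integrable.mul_bdd (hh.mono_set sdiff_subset) (c := 1 / η + 1)
      (Measurable.aestronglyMeasurable (by fun_prop)) ?_
    filter_upwards [ae_restrict_mem mS] with y hy
    rw [norm_inv, norm_mul, Complex.norm_ofNat]
    have h1 := hrη y hy
    have h2 : 0 < ‖denRoot L₀ α y‖ := norm_pos_iff.2 (hr0 y hy)
    have h3 : ‖denRoot L₀ α y‖⁻¹ ^ 2 ≤ 1 / η := by
      rw [inv_pow, ← one_div]
      gcongr
    rw [mul_inv]
    nlinarith [sq_nonneg (‖denRoot L₀ α y‖⁻¹ - 1), inv_pos.2 h2]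
  have h1 := bddReachable_inner_pole hL hL₀ hT hα mS hSI 1 (by norm_num) mβ hβi
  have h2 := bddReachable_inner_pole hL hL₀ hT hα mS hSI (-1) (by norm_num) mβ.neg hβi.neg
  refine (h1.2.add hL h2.2).congr fun x hx => ?_
  rw [← integral_add (h1.1 x hx) (h2.1 x hx)]
  refine setIntegral_congr_fun mS fun y hy => ?_
  have hD : cauchyDen L₀ α x y ≠ 0 := fun h0 => by
    have := le_re_cauchyDen hL₀ α (Ioo_subset_Icc_self hx) (hSI hy)
    rw [h0, Complex.zero_re] at this
    nlinarith
  have hr := hr0 y hy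
  rw [cauchyDen_eq] at hD ⊢
  have e1 := left_ne_zero_of_mul hD
  have e2 := right_ne_zero_of_mul hD
  simp only [hβ, Pi.neg_apply, one_mul, neg_one_mul, ← sub_eq_add_neg]
  field_simp
  ring

theorem bddReachable_cauchy {L L₀ T : ℝ} (hL : 0 < L) (hL₀ : L < L₀) (hT : 0 < T) {α : ℝ → ℝ}
    (hα : Continuous α) {h : ℝ → ℂ} (hh : IntegrableOn h (Ioo (-L₀) L₀)) (q : ℂ) :
    BddReachable L T fun x => q * ∫ y in Ioo (-L₀) L₀, h y / cauchyDen L₀ α x y := by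
  -- The constant is folded into the density, which is replaced by a genuinely measurable
  -- representative.
  obtain ⟨g, hg, hhg⟩ := hh.aestronglyMeasurable.const_mul q
  have hgi : IntegrableOn g (Ioo (-L₀) L₀) := (hh.const_mul q).congr hhg
  have mS : MeasurableSet {y : ℝ | (L + L₀) / 2 < |y|} :=
    measurableSet_lt measurable_const measurable_norm
  refine ((bddReachable_outer hL hL₀ hT hα hg.measurable hgi).add hL
    (bddReachable_inner hL hL₀ hT hα hg.measurable hgi)).congr fun x hx => ?_
  rw [integral_inter_add_sdiff mS (integrableOn_div_cauchyDen hL₀ hα hgi (Ioo_subset_Icc_self hx)),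
    ← integral_const_mul]
  refine integral_congr_ae ?_
  filter_upwards [hhg] with y hy
  rw [← hy, mul_div_assoc]

/-! ### The formula for `w₀`, square integrability, conclusion -/

theorem heatKernel_mul_source (L₀ : ℝ) (α : ℝ → ℝ) (h : ℝ → ℂ) (x y : ℝ) {t : ℝ} (ht : 0 < t) :
    (heatKernel t (x - y) : ℂ) * source L₀ α h t y =
      ((1 / Real.sqrt (4 * Real.pi) : ℝ) : ℂ) *
        (((t ^ 2 : ℝ) : ℂ)⁻¹ * Complex.exp (-cauchyDen L₀ α x y / (4 * t)) * h y) := by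
  have ht' : (t : ℂ) ≠ 0 := by exact_mod_cast ht.ne'
  have e1 : Real.sqrt (4 * Real.pi * t) * t ^ (3 / 2 : ℝ) = Real.sqrt (4 * Real.pi) * t ^ 2 := by
    rw [Real.sqrt_mul (by positivity), Real.sqrt_eq_rpow t, mul_assoc, ← Real.rpow_add ht]
    norm_num
  have e2 : -cauchyDen L₀ α x y / (4 * t) = ((-(x - y) ^ 2 / (4 * t) : ℝ) : ℂ) +
      (((y ^ 2 - L₀ ^ 2) / (4 * t) : ℝ) + Complex.I * ((α y / (4 * t) : ℝ) : ℂ)) := by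
    rw [cauchyDen]
    push_cast
    field_simp
    ring
  have e3 : (1 / Real.sqrt (4 * Real.pi * t)) * (1 / t ^ (3 / 2 : ℝ)) =
      1 / Real.sqrt (4 * Real.pi) * (t ^ 2)⁻¹ := by
    rw [one_div_mul_one_div, e1, one_div, one_div, mul_inv]
  have e4 : ((1 / Real.sqrt (4 * Real.pi * t) : ℝ) : ℂ) * (1 / ((t ^ (3 / 2 : ℝ) : ℝ) : ℂ)) =
      ((1 / Real.sqrt (4 * Real.pi) : ℝ) : ℂ) * ((t ^ 2 : ℝ) : ℂ)⁻¹ := by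
    have := congrArg (Complex.ofReal) e3
    simpa using this
  rw [e2, Complex.exp_add, heatKernel, source, Complex.ofReal_mul, Complex.ofReal_exp]
  linear_combination (Complex.exp ((-(x - y) ^ 2 / (4 * t) : ℝ) : ℂ) *
    Complex.exp (((y ^ 2 - L₀ ^ 2) / (4 * t) : ℝ) + Complex.I * ((α y / (4 * t) : ℝ) : ℂ)) * h y) * e4

/-- Since `Re A ≥ (L₀ - L)²`, the integrand is dominated by a constant times the product of `t⁻² exp
(-(L₀ - L)² / 4t)` and `‖h(y)‖`. -/
theorem integrable_heatKernel_source {L L₀ : ℝ} (hL₀ : L < L₀) {α : ℝ → ℝ} (hα : Continuous α)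
    {h : ℝ → ℂ} (hh : IntegrableOn h (Ioo (-L₀) L₀)) {x : ℝ} (hx : x ∈ Icc (-L) L) :
    IntegrableOn (fun p : ℝ × ℝ => (heatKernel p.1 (x - p.2) : ℂ) * source L₀ α h p.1 p.2)
      (Ioi (0 : ℝ) ×ˢ Ioo (-L₀) L₀) := by
  have hδ : 0 < (L₀ - L) ^ 2 := by
    have : 0 < L₀ - L := by linarith
    positivity
  have mset : MeasurableSet (Ioi (0 : ℝ) ×ˢ Ioo (-L₀) L₀) := measurableSet_Ioi.prod measurableSet_Ioo
  have mD : Measurable fun p : ℝ × ℝ => cauchyDen L₀ α x p.2 :=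
    (measurable_cauchyDen hα x).comp measurable_snd
  have key : IntegrableOn (fun p : ℝ × ℝ => ((1 / Real.sqrt (4 * Real.pi) : ℝ) : ℂ) *
      (((p.1 ^ 2 : ℝ) : ℂ)⁻¹ * Complex.exp (-cauchyDen L₀ α x p.2 / (4 * p.1)) * h p.2))
      (Ioi (0 : ℝ) ×ˢ Ioo (-L₀) L₀) := by
    have hre : 0 < ((((L₀ - L) ^ 2 : ℝ) : ℂ)).re := by rwa [Complex.ofReal_re]
    refine Integrable.const_mul ?_ _
    have hdom := (integrableOn_exp_primitive hre).norm.mul_prod hh.norm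
    rw [Measure.prod_restrict, ← Measure.volume_eq_prod] at hdom
    refine hdom.mono' ?_ ?_
    · refine AEStronglyMeasurable.mul (Measurable.aestronglyMeasurable (by fun_prop)) ?_
      rw [Measure.volume_eq_prod, ← Measure.prod_restrict]
      exact hh.aestronglyMeasurable.comp_snd
    · filter_upwards [ae_restrict_mem mset] with p hp
      rw [norm_mul, norm_inv_sq_mul_exp, norm_inv_sq_mul_exp, Complex.ofReal_re]
      have h1 := le_re_cauchyDen hL₀ α hx (Ioo_subset_Icc_self hp.2)
      have hp1 : 0 < p.1 := hp.1
      gcongr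
  exact key.congr_fun (fun p hp => (heatKernel_mul_source L₀ α h x p.2 hp.1).symm) mset

theorem w₀_eq {L L₀ : ℝ} (hL₀ : L < L₀) {α : ℝ → ℝ} (hα : Continuous α)
    {h : ℝ → ℂ} (hh : IntegrableOn h (Ioo (-L₀) L₀)) {x : ℝ} (hx : x ∈ Icc (-L) L) :
    w₀ L₀ α h x = ((2 / Real.sqrt Real.pi : ℝ) : ℂ) *
      ∫ y in Ioo (-L₀) L₀, h y / cauchyDen L₀ α x y := by
  have hi := integrable_heatKernel_source hL₀ hα hh hx
  rw [IntegrableOn, Measure.volume_eq_prod, ← Measure.prod_restrict] at hi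
  rw [w₀, Measure.volume_eq_prod, ← Measure.prod_restrict, integral_prod_symm _ hi,
    ← integral_const_mul]
  refine setIntegral_congr_fun measurableSet_Ioo fun y hy => ?_
  have hre : 0 < (cauchyDen L₀ α x y).re := by
    refine lt_of_lt_of_le ?_ (le_re_cauchyDen hL₀ α hx (Ioo_subset_Icc_self hy))
    have : 0 < L₀ - L := by linarith
    positivity
  have hc : ((1 / Real.sqrt (4 * Real.pi) : ℝ) : ℂ) * 4 = ((2 / Real.sqrt Real.pi : ℝ) : ℂ) := by
    have h4 : Real.sqrt (4 * Real.pi) = 2 * Real.sqrt Real.pi := by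
      rw [Real.sqrt_mul (by norm_num), show (4 : ℝ) = 2 ^ 2 by norm_num,
        Real.sqrt_sq (by norm_num)]
    rw [h4]
    push_cast
    field_simp
    norm_num
  simp only
  rw [setIntegral_congr_fun measurableSet_Ioi
    (fun t ht => heatKernel_mul_source L₀ α h x y ht), integral_const_mul, integral_mul_const,
    integral_Ioi_exp_primitive hre, ← hc]
  ring

/-- By dominated convergence the state is continuous up to `±L`, hence bounded. -/
theorem memLp_cauchy {L L₀ : ℝ} (hL₀ : L < L₀) {α : ℝ → ℝ} (hα : Continuous α)
    {h : ℝ → ℂ} (hh : IntegrableOn h (Ioo (-L₀) L₀)) (q : ℂ) :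
    MemLp (fun x => q * ∫ y in Ioo (-L₀) L₀, h y / cauchyDen L₀ α x y) 2
      (volume.restrict (Ioo (-L) L)) := by
  have hδ : 0 < (L₀ - L) ^ 2 := by
    have : 0 < L₀ - L := by linarith
    positivity
  have hcont : ContinuousOn (fun x => ∫ y in Ioo (-L₀) L₀, h y / cauchyDen L₀ α x y)
      (Icc (-L) L) := by
    refine continuousOn_of_dominated (bound := fun y => ‖h y‖ / (L₀ - L) ^ 2) (fun x hx => ?_)
      (fun x hx => ?_) (hh.norm.div_const _) ?_
    · exact (integrableOn_div_cauchyDen hL₀ hα hh hx).aestronglyMeasurable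
    · filter_upwards [ae_restrict_mem measurableSet_Ioo] with y hy
      rw [norm_div]
      gcongr
      exact (le_re_cauchyDen hL₀ α hx (Ioo_subset_Icc_self hy)).trans (Complex.re_le_norm _)
    · filter_upwards [ae_restrict_mem measurableSet_Ioo] with y hy
      refine continuousOn_const.div ?_ fun x hx h0 => ?_
      · unfold cauchyDen
        fun_prop
      · have := le_re_cauchyDen hL₀ α hx (Ioo_subset_Icc_self hy)
        rw [h0, Complex.zero_re] at this
        linarith
  have hcont' := (continuousOn_const (c := q)).mul hcont
  obtain ⟨C, hC⟩ := isCompact_Icc.exists_bound_of_continuousOn hcont'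
  refine MemLp.of_bound
    ((hcont'.mono Ioo_subset_Icc_self).aestronglyMeasurable measurableSet_Ioo) C ?_
  filter_upwards [ae_restrict_mem measurableSet_Ioo] with x hx
  exact hC x (Ioo_subset_Icc_self hx)

theorem w₀_congr {L₀ : ℝ} {α α' : ℝ → ℝ} (hαα' : ∀ y ∈ Icc (-L₀) L₀, α' y = α y) (h : ℝ → ℂ) :
    w₀ L₀ α' h = w₀ L₀ α h := by
  funext x
  refine setIntegral_congr_fun (measurableSet_Ioi.prod measurableSet_Ioo) fun p hp => ?_
  simp only [source, hαα' p.2 (Ioo_subset_Icc_self hp.2)]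

theorem kernelIntegrand_eq (L₀ : ℝ) (α : ℝ → ℝ) (h : ℝ → ℂ) (x y : ℝ) :
    kernelIntegrand L₀ α h x y = h y / cauchyDen L₀ (fun y => -α y) x y := by
  simp [kernelIntegrand, cauchyDen]

theorem K_congr {L₀ : ℝ} {α α' : ℝ → ℝ} (hαα' : ∀ y ∈ Icc (-L₀) L₀, α' y = α y) (h : ℝ → ℂ)
    (x : ℝ) : K L₀ α h x = ((2 / Real.sqrt Real.pi : ℝ) : ℂ) *
      ∫ y in Ioo (-L₀) L₀, h y / cauchyDen L₀ (fun y => -α' y) x y := by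
  rw [K]
  congr 1
  refine setIntegral_congr_fun measurableSet_Ioo fun y hy => ?_
  rw [kernelIntegrand_eq]
  simp only [cauchyDen, hαα' y (Ioo_subset_Icc_self hy)]

end HeatReach

end

open HeatReach in
theorem theorem4 (L L₀ : ℝ) (hL : 0 < L) (hL₀ : L < L₀) (α : ℝ → ℝ)
    (hα : ContinuousOn α (Set.Icc (-L₀) L₀)) :
    (∀ h : ℝ → ℂ, MemLp h 2 (volume.restrict (Set.Ioo (-L₀) L₀)) →
      -- the double integral that defines `w₀` converges absolutely
      (∀ x ∈ Set.Ioo (-L) L,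
        IntegrableOn
          (fun p : ℝ × ℝ =>
            (HeatReach.heatKernel p.1 (x - p.2) : ℂ) * HeatReach.source L₀ α h p.1 p.2)
          (Set.Ioi (0 : ℝ) ×ˢ Set.Ioo (-L₀) L₀)) ∧
      -- `w₀` is square integrable and reachable in every time
      MemLp (HeatReach.w₀ L₀ α h) 2 (volume.restrict (Set.Ioo (-L) L)) ∧
      (∀ T : ℝ, 0 < T → HeatReach.w₀ L₀ α h ∈ HeatReach.reachableSet L T) ∧
      -- the formula for `w₀`
      (∀ x ∈ Set.Ioo (-L) L,
        IntegrableOn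
          (fun y : ℝ => h y /
            ((((x - y) ^ 2 + L₀ ^ 2 - y ^ 2 : ℝ) : ℂ) - Complex.I * (α y : ℂ)))
          (Set.Ioo (-L₀) L₀) ∧
        HeatReach.w₀ L₀ α h x =
          ((2 / Real.sqrt Real.pi : ℝ) : ℂ) * ∫ y in Set.Ioo (-L₀) L₀, h y /
            ((((x - y) ^ 2 + L₀ ^ 2 - y ^ 2 : ℝ) : ℂ) - Complex.I * (α y : ℂ)))) ∧
    -- the range of `K_α` consists of square integrable reachable states
    (∀ h : ℝ → ℂ, MemLp h 2 (volume.restrict (Set.Ioo (-L₀) L₀)) →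
      (∀ x ∈ Set.Ioo (-L) L,
        IntegrableOn (HeatReach.kernelIntegrand L₀ α h x) (Set.Ioo (-L₀) L₀)) ∧
      MemLp (HeatReach.K L₀ α h) 2 (volume.restrict (Set.Ioo (-L) L))) ∧
    (∀ T : ℝ, 0 < T → HeatReach.rangeK L₀ α ⊆ HeatReach.reachableSet L T) := by
  have hle : -L₀ ≤ L₀ := by linarith
  -- Only the values of `α` on `[-L₀, L₀]` matter, so it is extended to a continuous function on the
  -- line.
  obtain ⟨α', hα'c, hα'⟩ : ∃ α' : ℝ → ℝ, Continuous α' ∧ ∀ y ∈ Icc (-L₀) L₀, α' y = α y :=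
    ⟨IccExtend hle ((Icc (-L₀) L₀).domRestrict α), hα.domRestrict.Icc_extend',
      fun y hy => IccExtend_of_mem hle _ hy⟩
  have h_int : ∀ h : ℝ → ℂ, MemLp h 2 (volume.restrict (Ioo (-L₀) L₀)) →
      IntegrableOn h (Ioo (-L₀) L₀) := fun h hh => hh.integrable one_le_two
  have hden : ∀ x, ∀ y ∈ Ioo (-L₀) L₀, cauchyDen L₀ α' x y =
      (((x - y) ^ 2 + L₀ ^ 2 - y ^ 2 : ℝ) : ℂ) - Complex.I * (α y : ℂ) := fun x y hy => by
    rw [cauchyDen, hα' y (Ioo_subset_Icc_self hy)]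
  have hw : ∀ h : ℝ → ℂ, MemLp h 2 (volume.restrict (Ioo (-L₀) L₀)) → ∀ x ∈ Ioo (-L) L,
      ((2 / Real.sqrt Real.pi : ℝ) : ℂ) * ∫ y in Ioo (-L₀) L₀, h y / cauchyDen L₀ α' x y =
        w₀ L₀ α h x := fun h hh x hx => by
    rw [← w₀_congr hα' h, w₀_eq hL₀ hα'c (h_int h hh) (Ioo_subset_Icc_self hx)]
  refine ⟨fun h hh => ⟨fun x hx => ?_, ?_, fun T hT => ?_, fun x hx => ⟨?_, ?_⟩⟩,
    fun h hh => ⟨fun x hx => ?_, ?_⟩, ?_⟩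
  · refine (integrable_heatKernel_source hL₀ hα'c (h_int h hh) (Ioo_subset_Icc_self hx)).congr_fun
      (fun p hp => ?_) (measurableSet_Ioi.prod measurableSet_Ioo)
    simp only [source, hα' p.2 (Ioo_subset_Icc_self hp.2)]
  · refine (memLp_congr_ae ?_).1
      (memLp_cauchy hL₀ hα'c (h_int h hh) ((2 / Real.sqrt Real.pi : ℝ) : ℂ))
    filter_upwards [ae_restrict_mem measurableSet_Ioo] with x hx using hw h hh x hx
  · exact ((bddReachable_cauchy hL hL₀ hT hα'c (h_int h hh) _).congr (hw h hh)).mem_reachableSet hL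
  · refine (integrableOn_div_cauchyDen hL₀ hα'c (h_int h hh) (Ioo_subset_Icc_self hx)).congr_fun
      (fun y hy => ?_) measurableSet_Ioo
    simp only [hden x y hy]
  · rw [← hw h hh x hx]
    congr 1
    exact setIntegral_congr_fun measurableSet_Ioo fun y hy => by simp only [hden x y hy]
  · refine (integrableOn_div_cauchyDen hL₀ hα'c.neg (h_int h hh) (Ioo_subset_Icc_self hx)).congr_fun
      (fun y hy => ?_) measurableSet_Ioo
    rw [kernelIntegrand_eq]
    simp only [cauchyDen, Pi.neg_apply, hα' y (Ioo_subset_Icc_self hy)]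
  · rw [show K L₀ α h = _ from funext (K_congr hα' h)]
    exact memLp_cauchy hL₀ hα'c.neg (h_int h hh) _
  -- `K_α` is the formula for `w₀` with `α` replaced by `-α`.
  · rintro T hT k ⟨h, hh, rfl⟩
    rw [show K L₀ α h = _ from funext (K_congr hα' h)]
    exact (bddReachable_cauchy hL hL₀ hT hα'c.neg (h_int h hh) _).mem_reachableSet hL
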